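/- Let $n,p\ge 1$ be integers. Let $\mathfrak{osp}(1|2n)$ be the Lie superalgebra generated by odd elements $B_1^\pm,\dots,B_n^\pm$ with relations $$[\{B_i^\xi,B_j^\eta\},B_l^\epsilon]=(\epsilon-\xi)\delta_{il}B_j^\eta+(\epsilon-\eta)\delta_{jl}B_i^\xi\qquad(\xi,\eta,\epsilon\in\{\pm1\}).$$ Let $\overline V_n(p)$ be the $\mathfrak{osp}(1|2n)$-module induced from the one-dimensional module $\mathbb C|0\rangle$ of the subalgebra spanned by all $\{B_i^+,B_j^-\}$, $B_i^-$, $\{B_i^-,B_j^-\}$, on which $B_i^-|0\rangle=0$ and $\{B_i^+,B_j^-\}|0\rangle=p\,\delta_{ij}|0\rangle$. For an integer $q\ge1$ let $\mathcal{C}\ell_q$ be the complex Clifford algebra with generators $e_1,\dots,e_q$, $\{e_\alpha,e_\beta\}=2\delta_{\alpha\beta}$. On $\mathbb C[x_{i,\alpha}:1\le i\le n,1\le\alpha\le q]\otimes\mathcal{C}\ell_q$ put $X_i=\sum_\alpha x_{i,\alpha}e_\alpha$ and $D_i=\sum_\alpha\partial_{x_{i,\alpha}}e_\alpha$ (with $e_\alpha$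 acting by left multiplication), and let $L_n(q)$ be the subspace generated from $1$ by the operators $X_i,D_i$; here $B_i^+$ acts as $X_i$ and $B_i^-$ as $D_i$. Let $\mathbb Y_n$ be the set of semistandard Young tableaux with entries in $\{1,\dots,n\}$, and $\mathbb Y_n(q)$ the subset of those with at most $q$ rows. For $A\in\mathbb Y_n$ with columns $a_1,\dots,a_m$ from left to right, and operators $b_1,\dots,b_n$, put $b_A=b_{a_m}\cdots b_{a_1}$, where $b_I=\sum_{\sigma\in S_k}\operatorname{sgn}(\sigma)\,b_{i_{\sigma(1)}}\cdots b_{i_{\sigma(k)}}$ for a column $I=(i_1<\dots<i_k)$; let $\lambda_A!$ be the product of the factorials of the column lengths of $A$. Put $$\tilde v_A(p)=\tfrac1{\lambda_A!}B_A^+|0\rangle\in\overline V_n(p),\qquad \tilde\omega_A(q)=\tfrac1{\lambda_A!}X_A(1)\in L_n(q).$$ Then $\{\tilde\omega_A(q):A\in\mathbb Y_n(q)\}$ is a basis of $L_n(q)$ for every $q\ge1$, and $\{\tilde v_A(p):A\in\mathbb Y_n\}$ is a basis of $\overline V_n(p)$. Let $\bar c_B(i,q,A)$ and $\hat c_B(i,q,A)$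 be the coefficients determined, for $A\in\mathbb Y_n(q)$, by $$X_i\tilde\omega_A(q)=\sum_{B\in\mathbb Y_n(q)}\bar c_B(i,q,A)\,\tilde\omega_B(q),\qquad D_i\tilde\omega_A(q)=\sum_{B\in\mathbb Y_n(q)}\hat c_B(i,q,A)\,\tilde\omega_B(q).$$ (For $q\ge n$ one has $\mathbb Y_n(q)=\mathbb Y_n$.) For all $i\in\{1,\dots,n\}$ and $A\in\mathbb Y_n$, $$B_i^+\tilde v_A(p)=\sum_{B\in\mathbb Y_n}\bar c_B(i,n,A)\,\tilde v_B(p),$$ $$B_i^-\tilde v_A(p)=\sum_{B\in\mathbb Y_n}\big((n+1-p)\,\hat c_B(i,n,A)-(n-p)\,\hat c_B(i,n+1,A)\big)\,\tilde v_B(p).$$ Moreover, for all $i\in\{1,\dots,n\}$ and $A\in\mathbb Y_n(p)$, $$X_i\tilde\omega_A(p)=\sum_{B\in\mathbb Y_n(p)}\bar c_B(i,n,A)\,\tilde\omega_B(p),$$ $$D_i\tilde\omega_A(p)=\sum_{B\in\mathbb Y_n(p)}\big((n+1-p)\,\hat c_B(i,n,A)-(n-p)\,\hat c_B(i,n+1,A)\big)\,\tilde\omega_B(p).$$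 -/

import Mathlib

open scoped TensorProduct

namespace Paraboson

noncomputable section

/-! ### The Lie superalgebra `osp(1|2n)` and its enveloping algebra -/

/-- The defining relations `[{B_i^ξ, B_j^η}, B_l^ε] = (ε - ξ) δ_{il} B_j^η + (ε - η) δ_{jl} B_i^ξ`
of `osp(1|2n)`, on free generators indexed by `i : Fin n` and a sign `±1 : ℤˣ`. -/
inductive Rel (n : ℕ) :
    FreeAlgebra ℂ (Fin n × ℤˣ) → FreeAlgebra ℂ (Fin n × ℤˣ) → Prop
  | triple (i j l : Fin n) (ξ η ε : ℤˣ) :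
      Rel n
        ((FreeAlgebra.ι ℂ (i, ξ) * FreeAlgebra.ι ℂ (j, η)
            + FreeAlgebra.ι ℂ (j, η) * FreeAlgebra.ι ℂ (i, ξ)) * FreeAlgebra.ι ℂ (l, ε)
          - FreeAlgebra.ι ℂ (l, ε) * (FreeAlgebra.ι ℂ (i, ξ) * FreeAlgebra.ι ℂ (j, η)
            + FreeAlgebra.ι ℂ (j, η) * FreeAlgebra.ι ℂ (i, ξ)))
        ((if i = l then (((ε : ℤ) - (ξ : ℤ) : ℤ) : ℂ) else 0) • FreeAlgebra.ι ℂ (j, η)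
          + (if j = l then (((ε : ℤ) - (η : ℤ) : ℤ) : ℂ) else 0) • FreeAlgebra.ι ℂ (i, ξ))

/-- The universal enveloping algebra of the Lie superalgebra `osp(1|2n)`, which is presented by
the odd generators `B_i^±` and the triple relations. -/
def UOsp (n : ℕ) : Type := RingQuot (Rel n)

instance (n : ℕ) : Ring (UOsp n) := inferInstanceAs (Ring (RingQuot (Rel n)))

instance (n : ℕ) : Algebra ℂ (UOsp n) := inferInstanceAs (Algebra ℂ (RingQuot (Rel n)))

/-- The generator `B_i^ξ`, for a sign `ξ = ±1`. -/
def gen (n : ℕ) (ξ : ℤˣ) (i : Fin n) : UOsp n :=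
  (RingQuot.mkAlgHom ℂ (Rel n) (FreeAlgebra.ι ℂ (i, ξ)) : RingQuot (Rel n))

/-! ### The induced module -/

/-- The left ideal generated by the elements `x - χ(x)`, where `x` runs through the spanning set
`B_i^-`, `{B_i^-, B_j^-}`, `{B_i^+, B_j^-}` of the parabolic subalgebra and `χ(x)` is the scalar
by which `x` acts on the vacuum: `0`, `0` and `p δ_{ij}` respectively. -/
def vacuumIdeal (n p : ℕ) : Ideal (UOsp n) :=
  Ideal.span
    (Set.range (fun i : Fin n => gen n (-1) i)
      ∪ Set.range (fun ij : Fin n × Fin n =>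
          gen n (-1) ij.1 * gen n (-1) ij.2 + gen n (-1) ij.2 * gen n (-1) ij.1)
      ∪ Set.range (fun ij : Fin n × Fin n =>
          gen n 1 ij.1 * gen n (-1) ij.2 + gen n (-1) ij.2 * gen n 1 ij.1
            - algebraMap ℂ (UOsp n) (if ij.1 = ij.2 then (p : ℂ) else 0)))

/-- The module induced from the one-dimensional module `ℂ|0⟩` of the parabolic subalgebra:
inducing a one-dimensional module with character `χ` gives the quotient of the enveloping algebra
by the left ideal generated by all `x - χ(x)`. -/
def VBar (n p : ℕ) : Type := UOsp n ⧸ vacuumIdeal n p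

instance (n p : ℕ) : AddCommGroup (VBar n p) :=
  inferInstanceAs (AddCommGroup (UOsp n ⧸ vacuumIdeal n p))

instance (n p : ℕ) : Module (UOsp n) (VBar n p) :=
  inferInstanceAs (Module (UOsp n) (UOsp n ⧸ vacuumIdeal n p))

instance (n p : ℕ) : Module ℂ (VBar n p) :=
  inferInstanceAs (Module ℂ (UOsp n ⧸ vacuumIdeal n p))

instance (n p : ℕ) : IsScalarTower ℂ (UOsp n) (VBar n p) :=
  inferInstanceAs (IsScalarTower ℂ (UOsp n) (UOsp n ⧸ vacuumIdeal n p))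

/-- The lowest weight vector `|0⟩`. -/
def vacuum (n p : ℕ) : VBar n p := (Submodule.Quotient.mk 1 : UOsp n ⧸ vacuumIdeal n p)

/-! ### Clifford algebra valued polynomials -/

/-- The complex Clifford algebra on `e_α`, `α : Fin p`, with `{e_α, e_β} = 2 δ_{αβ}`. -/
abbrev Cl (p : ℕ) : Type :=
  CliffordAlgebra (QuadraticMap.weightedSumSquares ℂ (fun _ : Fin p => (1 : ℂ)))

/-- The Clifford generator `e_α`. -/
def e {p : ℕ} (α : Fin p) : Cl p :=
  CliffordAlgebra.ι (QuadraticMap.weightedSumSquares ℂ (fun _ : Fin p => (1 : ℂ)))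
    (Pi.single α 1)

/-- Clifford algebra valued polynomials in the variables `x_{i,α}`. -/
abbrev ClPoly (n p : ℕ) : Type := MvPolynomial (Fin n × Fin p) ℂ ⊗[ℂ] Cl p

/-- `X_i = ∑_α x_{i,α} e_α`, as an operator. -/
def X (n p : ℕ) (i : Fin n) : Module.End ℂ (ClPoly n p) :=
  ∑ α : Fin p, TensorProduct.map
    (LinearMap.mulLeft ℂ (MvPolynomial.X (i, α) : MvPolynomial (Fin n × Fin p) ℂ))
    (LinearMap.mulLeft ℂ (e α))

/-- `D_i = ∑_α ∂_{i,α} e_α`, as an operator. -/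
def D (n p : ℕ) (i : Fin n) : Module.End ℂ (ClPoly n p) :=
  ∑ α : Fin p, TensorProduct.map
    (MvPolynomial.pderiv (R := ℂ) ((i, α) : Fin n × Fin p)).toLinearMap
    (LinearMap.mulLeft ℂ (e α))

/-- `L_n(p)`: the set of all `a(1)`, for `a` in the algebra of operators generated by the
`X_i` and `D_i`, that is, the `osp(1|2n)`-submodule generated by `1`. -/
def L (n p : ℕ) : Submodule ℂ (ClPoly n p) :=
  (Subalgebra.toSubmodule (Algebra.adjoin ℂ (Set.range (X n p) ∪ Set.range (D n p)))).map
    (LinearMap.applyₗ (1 : ClPoly n p))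

/-! ### Tableaux and tableau vectors -/

/-- Semistandard Young tableaux with entries in `{0, …, n-1}` (standing for `{1, …, n}`),
of arbitrary shape. -/
structure Tableau (n : ℕ) where
  shape : YoungDiagram
  filling : SemistandardYoungTableau shape
  entry_lt : ∀ {k l : ℕ}, (k, l) ∈ shape → filling k l < n

namespace Tableau

variable {n : ℕ}

/-- The number of rows. -/
def rows (A : Tableau n) : ℕ := A.shape.colLen 0

/-- The number of columns. -/
def cols (A : Tableau n) : ℕ := A.shape.rowLen 0

/-- The `l`-th column, from left to right, read downwards. -/
def col (A : Tableau n) (l : ℕ) (k : Fin (A.shape.colLen l)) : Fin n :=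
  ⟨A.filling k l, A.entry_lt (YoungDiagram.mem_iff_lt_colLen.mpr k.isLt)⟩

/-- `λ!`, the product of the factorials of the column lengths of the shape `λ`. -/
def shapeFactorial (A : Tableau n) : ℕ :=
  ∏ l ∈ Finset.range A.cols, (A.shape.colLen l).factorial

end Tableau

/-- The antisymmetrised product `∑_σ sgn(σ) b_{i_σ(1)} ⋯ b_{i_σ(k)}` for `I = (i_1, …, i_k)`. -/
def columnOp {R : Type*} [Ring R] {n k : ℕ} (b : Fin n → R) (I : Fin k → Fin n) : R :=
  ∑ σ : Equiv.Perm (Fin k),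
    ((Equiv.Perm.sign σ : ℤˣ) : ℤ) • (List.ofFn fun r => b (I (σ r))).prod

/-- `b_{a_m} ⋯ b_{a_1}`, where `a_1, …, a_m` are the columns of `A` from left to right. -/
def tableauOp {R : Type*} [Ring R] {n : ℕ} (b : Fin n → R) (A : Tableau n) : R :=
  (((List.range A.cols).map fun l => columnOp b (A.col l)).reverse).prod

/-- `v_A(p)`. -/
def v (n p : ℕ) (A : Tableau n) : VBar n p := tableauOp (gen n 1) A • vacuum n p

/-- `ω_A(p)`. -/
def ω (n p : ℕ) (A : Tableau n) : ClPoly n p := tableauOp (X n p) A 1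

/-- The normalised vector `v_A(p) / λ_A!`. -/
def vTilde (n p : ℕ) (A : Tableau n) : VBar n p := (A.shapeFactorial : ℂ)⁻¹ • v n p A

/-- The normalised vector `ω_A(p) / λ_A!`. -/
def ωTilde (n p : ℕ) (A : Tableau n) : ClPoly n p := (A.shapeFactorial : ℂ)⁻¹ • ω n p A

/-! ### Matrix elements -/

/-- The coordinates of `w` with respect to the normalised tableau vectors of `L_n(p)`, which are
indexed by the tableaux with at most `p` rows: the finitely supported `c` that vanishes on the
tableaux with more than `p` rows and satisfies `w = ∑_B c_B ω̃_B(p)`. -/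
def coords (n p : ℕ) (w : ClPoly n p) : Tableau n →₀ ℂ :=
  Classical.epsilon fun c : Tableau n →₀ ℂ =>
    (∀ B, p < B.rows → c B = 0) ∧ w = Finsupp.linearCombination ℂ (ωTilde n p) c

/-- The coefficients `c̄_B(i, p, A)` of `X_i ω̃_A(p)`, as a function of `B`. -/
def cBar (n p : ℕ) (i : Fin n) (A : Tableau n) : Tableau n →₀ ℂ :=
  coords n p (X n p i (ωTilde n p A))

/-- The coefficients `ĉ_B(i, p, A)` of `D_i ω̃_A(p)`, as a function of `B`. -/
def cHat (n p : ℕ) (i : Fin n) (A : Tableau n) : Tableau n →₀ ℂ :=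
  coords n p (D n p i (ωTilde n p A))

end

end Paraboson

/-!
Because the anticommutators of the `B_i^+` commute with the `B_j^+`, the antisymmetrised products
satisfy Garnir relations, and straightening writes every product of the `B_i^+` as a combination
of semistandard tableau products. In `L_n(q)` the vectors `ω̃_A(q)`, for `A` with at most `q` rows,
have distinct leading monomials with invertible Clifford coefficients and are linearly independent,
while those with more than `q` rows vanish.

The coefficients of `B_i^+` on the tableau vectors of `V̄_n(q)` do not depend on `q`, and those of
`B_i^-` are affine in `q`. As `V̄_n(q)` maps onto `L_n(q)`, where all tableau vectors are
independent if `q ≥ n`, they are determined by the cases `q = n` and `q = n + 1`. The matrices so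
obtained satisfy the relations of `osp(1|2n)` for infinitely many `q`, hence identically in `q`,
and they turn the formal span of all tableaux into a module with a lowest weight vector for every
`q`. This is an image of `V̄_n(q)` in which the tableau vectors are independent.
-/

namespace Paraboson

/-! ### Antisymmetrised products -/

section ColumnOp

variable {R S F : Type*} [Ring R] [Ring S] [FunLike F R S] [RingHomClass F R S] {n k l : ℕ}

/-- The product `b_{f(0)} b_{f(1)} ⋯ b_{f(k-1)}`, the word underlying a column. -/
def wordOp (b : Fin n → R) (f : Fin k → Fin n) : R := (List.ofFn fun r => b (f r)).prod

lemma wordOp_zero (b : Fin n → R) (f : Fin 0 → Fin n) : wordOp b f = 1 := by simp [wordOp]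

lemma wordOp_succ (b : Fin n → R) (f : Fin (k + 1) → Fin n) :
    wordOp b f = b (f 0) * wordOp b (fun r => f r.succ) := by
  simp [wordOp, List.ofFn_succ]

lemma map_wordOp (φ : F) (b : Fin n → R) (f : Fin k → Fin n) :
    φ (wordOp b f) = wordOp (fun i => φ (b i)) f := by
  simp only [wordOp, map_list_prod, List.map_ofFn, Function.comp_def]

lemma columnOp_eq_sum_wordOp (b : Fin n → R) (I : Fin k → Fin n) :
    columnOp b I = ∑ σ : Equiv.Perm (Fin k), Equiv.Perm.sign σ • wordOp b (I ∘ σ) := rfl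

lemma columnOp_eq_alternatization (b : Fin n → R) (I : Fin k → Fin n) :
    columnOp b I = (MultilinearMap.mkPiAlgebraFin ℤ k R).alternatization (b ∘ I) := by
  simp [columnOp_eq_sum_wordOp, wordOp, MultilinearMap.alternatization_apply]

lemma columnOp_comp_perm (b : Fin n → R) (I : Fin k → Fin n) (τ : Equiv.Perm (Fin k)) :
    columnOp b (I ∘ τ) = Equiv.Perm.sign τ • columnOp b I := by
  rw [columnOp_eq_alternatization, columnOp_eq_alternatization, ← Function.comp_assoc,
    AlternatingMap.map_perm]

lemma exists_columnOp_comp_equiv (b : Fin n → R) (e : Fin k ≃ Fin l) :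
    ∃ ε : ℤˣ, ∀ I : Fin l → Fin n, columnOp b (I ∘ e) = ε • columnOp b I := by
  obtain rfl : k = l := Fin.equiv_iff_eq.1 ⟨e⟩
  exact ⟨_, fun I => columnOp_comp_perm b I e⟩

lemma columnOp_eq_zero_of_not_injective (b : Fin n → R) {I : Fin k → Fin n}
    (h : ¬ Function.Injective I) : columnOp b I = 0 := by
  rw [columnOp_eq_alternatization]
  exact AlternatingMap.map_eq_zero_of_not_injective _ _ fun hI => h hI.of_comp

lemma columnOp_zero (b : Fin n → R) (I : Fin 0 → Fin n) : columnOp b I = 1 := by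
  simp [columnOp_eq_sum_wordOp, wordOp_zero]

lemma columnOp_one (b : Fin n → R) (i : Fin n) : columnOp b (fun _ : Fin 1 => i) = b i := by
  simp [columnOp_eq_sum_wordOp, wordOp_succ, wordOp_zero]

lemma map_columnOp (φ : F) (b : Fin n → R) (I : Fin k → Fin n) :
    φ (columnOp b I) = columnOp (fun i => φ (b i)) I := by
  simp only [columnOp_eq_sum_wordOp, map_sum, Units.smul_def, map_zsmul, map_wordOp]

end ColumnOp

section Spans

variable (𝕜 : Type*) {R : Type*} [CommRing 𝕜] [Ring R] [Algebra 𝕜 R] {n k : ℕ}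

/-- The linear span of the generators `b_i`. -/
def genSpan (b : Fin n → R) : Submodule 𝕜 R := Submodule.span 𝕜 (Set.range b)

/-- The linear span of the antisymmetrised products of `k` generators. -/
def colSpan (b : Fin n → R) (k : ℕ) : Submodule 𝕜 R :=
  Submodule.span 𝕜 (Set.range fun I : Fin k → Fin n => columnOp b I)

lemma mem_genSpan (b : Fin n → R) (i : Fin n) : b i ∈ genSpan 𝕜 b :=
  Submodule.subset_span ⟨i, rfl⟩

lemma columnOp_mem_colSpan (b : Fin n → R) (I : Fin k → Fin n) : columnOp b I ∈ colSpan 𝕜 b k :=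
  Submodule.subset_span ⟨I, rfl⟩

lemma wordOp_mem_genSpan_pow (b : Fin n → R) (f : Fin k → Fin n) :
    wordOp b f ∈ genSpan 𝕜 b ^ k := by
  induction k with
  | zero => rw [wordOp_zero, pow_zero]; exact Submodule.one_le.1 le_rfl
  | succ k ih =>
    rw [wordOp_succ, pow_succ']
    exact Submodule.mul_mem_mul (mem_genSpan 𝕜 b _) (ih _)

lemma colSpan_le_genSpan_pow (b : Fin n → R) (k : ℕ) : colSpan 𝕜 b k ≤ genSpan 𝕜 b ^ k := by
  rw [colSpan, Submodule.span_le]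
  rintro _ ⟨I, rfl⟩
  exact Submodule.sum_mem _ fun σ _ => zsmul_mem (wordOp_mem_genSpan_pow 𝕜 b _) _

end Spans

/-! ### Extension of scalars by a Grassmann algebra -/

section Grassmann

variable {𝕜 R V : Type*} [CommRing 𝕜] [Ring R] [Algebra 𝕜 R] [AddCommGroup V] [Module 𝕜 V]
  {k m : ℕ}

open ExteriorAlgebra (ιMulti)

lemma ι_mul_ιMulti (v : V) (w : Fin k → V) :
    ExteriorAlgebra.ι 𝕜 v * ιMulti 𝕜 k w
      = (-1 : ℤ) ^ k • (ιMulti 𝕜 k w * ExteriorAlgebra.ι 𝕜 v) := by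
  induction k with
  | zero => simp
  | succ k ih =>
    have hswap := eq_neg_of_add_eq_zero_left (ExteriorAlgebra.ι_add_mul_swap (R := 𝕜) v (w 0))
    rw [ExteriorAlgebra.ιMulti_succ_apply, ← mul_assoc, hswap, neg_mul, mul_assoc, ih,
      mul_smul_comm, pow_succ, mul_neg_one, neg_smul, mul_assoc]

variable (𝕜) in
/-- The coefficient of the top form `e₁ ∧ ⋯ ∧ e_m`. -/
noncomputable def topCoeff (m : ℕ) : ExteriorAlgebra 𝕜 (Fin m → 𝕜) →ₗ[𝕜] 𝕜 :=
  ExteriorAlgebra.liftAlternating (Pi.single m Matrix.detRowAlternating)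

variable (𝕜) in
/-- The top form `e₁ ∧ ⋯ ∧ e_m`. -/
noncomputable def topForm (m : ℕ) : ExteriorAlgebra 𝕜 (Fin m → 𝕜) :=
  ιMulti 𝕜 m fun i => Pi.single i 1

lemma topCoeff_topForm (m : ℕ) : topCoeff 𝕜 m (topForm 𝕜 m) = 1 := by
  rw [topCoeff, topForm, ExteriorAlgebra.liftAlternating_apply_ιMulti, Pi.single_eq_same,
    ← Matrix.det_one (n := Fin m) (R := 𝕜)]
  congr 1
  ext i j
  simp [Matrix.one_apply, Pi.single_apply, eq_comm]

/-- Application of a linear functional to the right tensor factor. -/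
noncomputable def contract {A : Type*} [AddCommGroup A] [Module 𝕜 A] (φ : A →ₗ[𝕜] 𝕜) :
    R ⊗[𝕜] A →ₗ[𝕜] R :=
  (TensorProduct.rid 𝕜 R).toLinearMap ∘ₗ LinearMap.lTensor R φ

lemma contract_tmul {A : Type*} [AddCommGroup A] [Module 𝕜 A] (φ : A →ₗ[𝕜] 𝕜) (w : R) (g : A) :
    contract φ (w ⊗ₜ[𝕜] g) = φ g • w := by
  simp [contract]

lemma tmul_topForm_injective :
    Function.Injective fun w : R => w ⊗ₜ[𝕜] topForm 𝕜 m := fun w w' h => by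
  simpa [contract_tmul, topCoeff_topForm] using congrArg (contract (topCoeff 𝕜 m)) h

variable (V) in
/-- The extension of a subspace of `R` to the Grassmann envelope `R ⊗ Λ V`. -/
noncomputable def env (W : Submodule 𝕜 R) : Submodule 𝕜 (R ⊗[𝕜] ExteriorAlgebra 𝕜 V) :=
  Submodule.map₂ (TensorProduct.mk 𝕜 R (ExteriorAlgebra 𝕜 V)) W ⊤

lemma tmul_mem_env {W : Submodule 𝕜 R} {w : R} (hw : w ∈ W) (g : ExteriorAlgebra 𝕜 V) :
    w ⊗ₜ[𝕜] g ∈ env V W :=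
  Submodule.apply_mem_map₂ _ hw Submodule.mem_top

lemma env_mono {W W' : Submodule 𝕜 R} (h : W ≤ W') : env V W ≤ env V W' :=
  Submodule.map₂_le_map₂_left h

lemma env_mul_le (W W' : Submodule 𝕜 R) : env V W * env V W' ≤ env V (W * W') := by
  rw [env, env, Submodule.map₂_eq_span_image2, Submodule.map₂_eq_span_image2,
    Submodule.span_mul_span, Submodule.span_le]
  rintro _ ⟨_, ⟨w, hw, g, -, rfl⟩, _, ⟨w', hw', g', -, rfl⟩, rfl⟩
  simp only [TensorProduct.mk_apply, Algebra.TensorProduct.tmul_mul_tmul]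
  exact tmul_mem_env (Submodule.mul_mem_mul hw hw') _

lemma mem_of_tmul_topForm_mem_env {W : Submodule 𝕜 R} {w : R}
    (h : w ⊗ₜ[𝕜] topForm 𝕜 m ∈ env (Fin m → 𝕜) W) : w ∈ W := by
  have hle : env (Fin m → 𝕜) W ≤ W.comap (contract (topCoeff 𝕜 m)) := by
    rw [env, Submodule.map₂_le]
    intro w hw g _
    rw [Submodule.mem_comap, TensorProduct.mk_apply, contract_tmul]
    exact W.smul_mem _ hw
  simpa only [Submodule.mem_comap, contract_tmul, topCoeff_topForm, one_smul] using hle h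

end Grassmann

section Eta

variable {𝕜 R V : Type*} [CommRing 𝕜] [Ring R] [Algebra 𝕜 R] [AddCommGroup V] [Module 𝕜 V]
  {L n : ℕ}

open ExteriorAlgebra (ιMulti)

variable (𝕜) in
/-- The odd element `∑ᵢ bᵢ ⊗ vᵢ` of the Grassmann envelope, whose powers are generating functions
of the antisymmetrised products of the `bᵢ`. -/
noncomputable def eta (b : Fin L → R) (v : Fin L → V) : R ⊗[𝕜] ExteriorAlgebra 𝕜 V :=
  ∑ i, b i ⊗ₜ[𝕜] ExteriorAlgebra.ι 𝕜 (v i)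

lemma list_prod_tmul {S : Type*} [Ring S] [Algebra 𝕜 S] {k : ℕ} (u : Fin k → R) (g : Fin k → S) :
    (List.ofFn fun r => u r ⊗ₜ[𝕜] g r).prod = (List.ofFn u).prod ⊗ₜ[𝕜] (List.ofFn g).prod := by
  induction k with
  | zero => simp [Algebra.TensorProduct.one_def]
  | succ k ih => simp [List.ofFn_succ, ih]

lemma eta_pow (b : Fin L → R) (v : Fin L → V) (k : ℕ) :
    eta 𝕜 b v ^ k = ∑ f : Fin k → Fin L, wordOp b f ⊗ₜ[𝕜] ιMulti 𝕜 k (v ∘ f) := by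
  have h := (MultilinearMap.mkPiAlgebraFin 𝕜 k (R ⊗[𝕜] ExteriorAlgebra 𝕜 V)).map_sum
    (fun (_ : Fin k) (i : Fin L) => b i ⊗ₜ[𝕜] ExteriorAlgebra.ι 𝕜 (v i))
  simp only [MultilinearMap.mkPiAlgebraFin_apply, List.ofFn_const, List.prod_replicate] at h
  simp only [eta, h, list_prod_tmul, ExteriorAlgebra.ιMulti_apply, wordOp, Function.comp_def]

lemma factorial_smul_eta_pow (b : Fin L → R) (v : Fin L → V) (k : ℕ) :
    k.factorial • eta 𝕜 b v ^ k
      = ∑ f : Fin k → Fin L, columnOp b f ⊗ₜ[𝕜] ιMulti 𝕜 k (v ∘ f) := by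
  have hσ (σ : Equiv.Perm (Fin k)) : ∑ f : Fin k → Fin L,
      (Equiv.Perm.sign σ • wordOp b (f ∘ σ)) ⊗ₜ[𝕜] ιMulti 𝕜 k (v ∘ f) = eta 𝕜 b v ^ k := by
    rw [eta_pow]
    refine Fintype.sum_equiv (Equiv.arrowCongr σ.symm (Equiv.refl _)) _ _ fun f => ?_
    change _ = wordOp b (f ∘ σ) ⊗ₜ[𝕜] ιMulti 𝕜 k ((v ∘ f) ∘ σ)
    rw [AlternatingMap.map_perm, TensorProduct.tmul_smul, TensorProduct.smul_tmul']
  simp only [columnOp_eq_sum_wordOp, TensorProduct.sum_tmul]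
  rw [Finset.sum_comm, Finset.sum_congr rfl fun σ _ => hσ σ, Finset.sum_const, Finset.card_univ,
    Fintype.card_perm, Fintype.card_fin]

lemma sum_tmul_ιMulti (F : (Fin L → Fin L) → R) (v : Fin L → V) :
    ∑ f : Fin L → Fin L, F f ⊗ₜ[𝕜] ιMulti 𝕜 L (v ∘ f)
      = (∑ σ : Equiv.Perm (Fin L), Equiv.Perm.sign σ • F σ) ⊗ₜ[𝕜] ιMulti 𝕜 L v := by
  rw [TensorProduct.sum_tmul]
  refine (Fintype.sum_of_injective (fun σ : Equiv.Perm (Fin L) => (σ : Fin L → Fin L))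
    Equiv.coe_fn_injective _ _ (fun f hf => ?_) fun σ => ?_).symm
  · have hinj : ¬ Function.Injective f := fun h =>
      hf ⟨Equiv.ofBijective f (Finite.injective_iff_bijective.1 h), rfl⟩
    rw [AlternatingMap.map_eq_zero_of_not_injective _ _ fun h => hinj h.of_comp,
      TensorProduct.tmul_zero]
  · rw [AlternatingMap.map_perm, TensorProduct.tmul_smul, TensorProduct.smul_tmul']

lemma eta_pow_card (b : Fin n → R) (x : Fin L → Fin n) (v : Fin L → V) :
    eta 𝕜 (b ∘ x) v ^ L = columnOp b x ⊗ₜ[𝕜] ιMulti 𝕜 L v := by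
  rw [eta_pow, sum_tmul_ιMulti]
  rfl

lemma eta_pow_eq_zero (b : Fin L → R) (v : Fin L → V) {k : ℕ} (hk : L < k) :
    eta 𝕜 b v ^ k = 0 := by
  rw [eta_pow]
  refine Finset.sum_eq_zero fun f _ => ?_
  have hf : ¬ Function.Injective (v ∘ f) := fun h => hk.not_ge <| by
    simpa using Fintype.card_le_of_injective f h.of_comp
  rw [AlternatingMap.map_eq_zero_of_not_injective _ _ hf, TensorProduct.tmul_zero]

lemma eta_mem_env (b : Fin n → R) (x : Fin L → Fin n) (v : Fin L → V) :
    eta 𝕜 (b ∘ x) v ∈ env V (genSpan 𝕜 b) :=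
  Submodule.sum_mem _ fun _ _ => tmul_mem_env (mem_genSpan 𝕜 b _) _

end Eta

section CharZero

variable {𝕜 R V : Type*} [Field 𝕜] [CharZero 𝕜] [Ring R] [Algebra 𝕜 R] [AddCommGroup V]
  [Module 𝕜 V] {L n : ℕ}

lemma mem_of_nsmul_mem {M : Type*} [AddCommGroup M] [Module 𝕜 M] {W : Submodule 𝕜 M} {m : ℕ}
    (hm : m ≠ 0) {z : M} (h : m • z ∈ W) : z ∈ W := by
  rwa [← Nat.cast_smul_eq_nsmul 𝕜, Submodule.smul_mem_iff _ (Nat.cast_ne_zero.2 hm)] at h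

lemma eta_pow_mem_env (b : Fin n → R) (x : Fin L → Fin n) (v : Fin L → V) (k : ℕ) :
    eta 𝕜 (b ∘ x) v ^ k ∈ env V (colSpan 𝕜 b k) := by
  refine mem_of_nsmul_mem k.factorial_ne_zero ?_
  rw [factorial_smul_eta_pow]
  exact Submodule.sum_mem _ fun f _ => tmul_mem_env (columnOp_mem_colSpan 𝕜 b (x ∘ f)) _

variable (𝕜) in
lemma colSpan_succ_le (b : Fin n → R) (k : ℕ) :
    colSpan 𝕜 b (k + 1) ≤ genSpan 𝕜 b * colSpan 𝕜 b k := by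
  rw [colSpan, Submodule.span_le]
  rintro _ ⟨I, rfl⟩
  apply mem_of_tmul_topForm_mem_env (𝕜 := 𝕜) (m := k + 1)
  rw [topForm, ← eta_pow_card, pow_succ']
  exact env_mul_le _ _ (Submodule.mul_mem_mul (eta_mem_env b I _) (eta_pow_mem_env b I _ k))

end CharZero

/-! ### Commutation with antisymmetrised products -/

section QCommutation

variable {T : Type*} [Ring T] {η β S : T}

lemma pow_mul_of_qCommute {q : ℤ} (hβ : η * β = q • (β * η) + S) (hS : η * S = q • (S * η))
    (k : ℕ) : η ^ (k + 1) * β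
      = q ^ (k + 1) • (β * η ^ (k + 1)) + ((k + 1) * q ^ k) • (S * η ^ k) := by
  induction k with
  | zero => simpa using hβ
  | succ k ih =>
    have hβ' : η * (β * η ^ (k + 1)) = q • (β * η ^ (k + 1 + 1)) + S * η ^ (k + 1) := by
      rw [← mul_assoc, hβ, add_mul, smul_mul_assoc, mul_assoc, ← pow_succ']
    have hS' : η * (S * η ^ k) = q • (S * η ^ (k + 1)) := by
      rw [← mul_assoc, hS, smul_mul_assoc, mul_assoc, ← pow_succ']
    have hpow : η ^ (k + 1 + 1) * β = η * (η ^ (k + 1) * β) := by rw [pow_succ', mul_assoc]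
    rw [hpow, ih, mul_add, mul_smul_comm, mul_smul_comm, hβ', hS']
    push_cast
    module

lemma add_pow_of_commutator (hβ : η * β = β * η + S) (hS : Commute η S) (hββ : β * β = 0)
    (hβS : β * S = 0) (k : ℕ) :
    (η + β) ^ (k + 2)
      = η ^ (k + 2) + (k + 2) • (β * η ^ (k + 1)) + (k + 2).choose 2 • (S * η ^ k) := by
  have hηβ (j : ℕ) : η * (β * η ^ j) = β * η ^ (j + 1) + S * η ^ j := by
    rw [← mul_assoc, hβ, add_mul, mul_assoc, ← pow_succ']
  have hβ0 (z : T) : β * (β * z) = 0 := by rw [← mul_assoc, hββ, zero_mul]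
  have hβS0 (z : T) : β * (S * z) = 0 := by rw [← mul_assoc, hβS, zero_mul]
  induction k with
  | zero => simp [sq, mul_add, add_mul, hββ, hβ, two_mul]; abel
  | succ k ih =>
    have hηS : η * (S * η ^ k) = S * η ^ (k + 1) := by
      rw [← mul_assoc, hS.eq, mul_assoc, ← pow_succ']
    have hchoose : (k + 3).choose 2 = (k + 2).choose 2 + (k + 2) := by
      rw [Nat.choose_succ_succ' (k + 2) 1, Nat.choose_one_right, add_comm]
    rw [pow_succ', ih]
    simp only [mul_add, add_mul, mul_smul_comm, hηβ, hηS, hβ0, hβS0, ← pow_succ',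
      add_zero]
    rw [hchoose]
    module

lemma two_smul_add_pow_of_commutator (hβ : η * β = β * η + S) (hS : Commute η S)
    (hββ : β * β = 0) (hβS : β * S = 0) (k : ℕ) :
    2 • (η + β) ^ (k + 1) = 2 • η ^ (k + 1) + (k + 1) • (β * η ^ k + η ^ k * β) := by
  cases k with
  | zero => simp [two_smul]
  | succ k =>
    have hcomm : η ^ (k + 1) * β = β * η ^ (k + 1) + (k + 1) • (S * η ^ k) := by
      simpa only [one_pow, one_zsmul, mul_one, ← Nat.cast_add_one, natCast_zsmul] using
        pow_mul_of_qCommute (q := 1) (by simpa using hβ) (by simpa using hS.eq) k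
    have hchoose : 2 * (k + 2).choose 2 = (k + 2) * (k + 1) := by
      rw [mul_comm, Nat.choose_two_right]
      exact Nat.div_mul_cancel (Nat.even_mul_pred_self (k + 2)).two_dvd
    rw [add_pow_of_commutator hβ hS hββ hβS, smul_add, smul_smul, hchoose, hcomm]
    module

end QCommutation

section TripleComm

/-- The anticommutators of the `b_i` commute with the `b_l`, as they do for either half of the
generators of `osp(1|2n)`. -/
def TripleComm {R : Type*} [Ring R] {n : ℕ} (b : Fin n → R) : Prop :=
  ∀ i j l, Commute (b i * b j + b j * b i) (b l)

open ExteriorAlgebra (ιMulti)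

section Commutator

variable {𝕜 R V : Type*} [CommRing 𝕜] [Ring R] [Algebra 𝕜 R] [AddCommGroup V] [Module 𝕜 V]
  {L n k : ℕ} {b : Fin n → R}

lemma ι_mul_ι (v w : V) : ExteriorAlgebra.ι 𝕜 v * ExteriorAlgebra.ι 𝕜 w
    = -(ExteriorAlgebra.ι 𝕜 w * ExteriorAlgebra.ι 𝕜 v) :=
  eq_neg_of_add_eq_zero_left (ExteriorAlgebra.ι_add_mul_swap v w)

lemma eta_mul_odd (x : Fin L → Fin n) (v : Fin L → V) (a : Fin n) (w : V) :
    eta 𝕜 (b ∘ x) v * (b a ⊗ₜ[𝕜] ExteriorAlgebra.ι 𝕜 w)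
      = (b a ⊗ₜ[𝕜] ExteriorAlgebra.ι 𝕜 w) * eta 𝕜 (b ∘ x) v
        + ∑ i, (b (x i) * b a + b a * b (x i)) ⊗ₜ[𝕜]
          (ExteriorAlgebra.ι 𝕜 (v i) * ExteriorAlgebra.ι 𝕜 w) := by
  simp only [eta, Finset.sum_mul, Finset.mul_sum, Algebra.TensorProduct.tmul_mul_tmul,
    TensorProduct.add_tmul, Finset.sum_add_distrib, ι_mul_ι w, TensorProduct.tmul_neg,
    Finset.sum_neg_distrib, Function.comp_apply]
  abel

lemma commute_eta_commutator (hb : TripleComm b) (x : Fin L → Fin n) (v : Fin L → V) (a : Fin n)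
    (w : V) : Commute (eta 𝕜 (b ∘ x) v) (∑ i, (b (x i) * b a + b a * b (x i)) ⊗ₜ[𝕜]
      (ExteriorAlgebra.ι 𝕜 (v i) * ExteriorAlgebra.ι 𝕜 w)) := by
  refine Commute.sum_left _ _ _ fun i _ => Commute.sum_right _ _ _ fun j _ => ?_
  have hι : ExteriorAlgebra.ι 𝕜 (v i) * (ExteriorAlgebra.ι 𝕜 (v j) * ExteriorAlgebra.ι 𝕜 w)
      = ExteriorAlgebra.ι 𝕜 (v j) * ExteriorAlgebra.ι 𝕜 w * ExteriorAlgebra.ι 𝕜 (v i) := by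
    rw [← mul_assoc, ι_mul_ι (v i), neg_mul, mul_assoc, ι_mul_ι (v i), mul_neg, neg_neg,
      mul_assoc]
  rw [Commute, SemiconjBy, Algebra.TensorProduct.tmul_mul_tmul,
    Algebra.TensorProduct.tmul_mul_tmul, hι, Function.comp_apply, (hb _ _ _).eq]

lemma odd_mul_commutator (x : Fin L → Fin n) (v : Fin L → V) (a : Fin n) (w : V) :
    (b a ⊗ₜ[𝕜] ExteriorAlgebra.ι 𝕜 w) * ∑ i, (b (x i) * b a + b a * b (x i)) ⊗ₜ[𝕜]
      (ExteriorAlgebra.ι 𝕜 (v i) * ExteriorAlgebra.ι 𝕜 w) = 0 := by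
  rw [Finset.mul_sum]
  refine Finset.sum_eq_zero fun i _ => ?_
  rw [Algebra.TensorProduct.tmul_mul_tmul, ι_mul_ι (v i), mul_neg, ← mul_assoc,
    ExteriorAlgebra.ι_sq_zero, zero_mul, neg_zero, TensorProduct.tmul_zero]

variable (𝕜) in
include 𝕜 in
lemma two_smul_columnOp_snoc (hb : TripleComm b) (x : Fin k → Fin n) (a : Fin n) :
    2 • columnOp b (Fin.snoc x a : Fin (k + 1) → Fin n)
      = (k + 1) • (columnOp b x * b a + (-1 : ℤ) ^ k • (b a * columnOp b x)) := by
  apply tmul_topForm_injective (𝕜 := 𝕜) (m := k + 1)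
  set v : Fin (k + 1) → Fin (k + 1) → 𝕜 := fun i => Pi.single i 1
  set η := eta 𝕜 (b ∘ x) (v ∘ Fin.castSucc)
  set β := b a ⊗ₜ[𝕜] ExteriorAlgebra.ι 𝕜 (v (Fin.last k))
  have hsplit : eta 𝕜 (b ∘ (Fin.snoc x a : Fin (k + 1) → Fin n)) v = η + β := by
    simp [eta, Fin.sum_univ_castSucc, η, β]
  have hββ : β * β = 0 := by simp [β]
  have hpow := two_smul_add_pow_of_commutator (eta_mul_odd x (v ∘ Fin.castSucc) a (v (Fin.last k)))
    (commute_eta_commutator hb x _ a _) hββ (odd_mul_commutator x _ a _) k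
  have htop : ιMulti 𝕜 k (v ∘ Fin.castSucc) * ExteriorAlgebra.ι 𝕜 (v (Fin.last k))
      = topForm 𝕜 (k + 1) := by
    simp only [topForm, ExteriorAlgebra.ιMulti_apply, List.ofFn_succ', List.concat_eq_append,
      List.prod_append, List.prod_singleton, Function.comp_def, v]
  rw [eta_pow_eq_zero _ _ k.lt_succ_self, smul_zero, zero_add, ← hsplit, eta_pow_card,
    eta_pow_card] at hpow
  simp only [Algebra.TensorProduct.tmul_mul_tmul, ι_mul_ιMulti, htop] at hpow
  rwa [TensorProduct.tmul_smul, TensorProduct.smul_tmul', TensorProduct.smul_tmul',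
    ← TensorProduct.add_tmul, TensorProduct.smul_tmul', add_comm (_ • (b a * _))] at hpow

end Commutator

variable {𝕜 R : Type*} [Field 𝕜] [CharZero 𝕜] [Ring R] [Algebra 𝕜 R] {n : ℕ} {b : Fin n → R}

lemma colSpan_mul_genSpan_le (hb : TripleComm b) (k : ℕ) :
    colSpan 𝕜 b k * genSpan 𝕜 b ≤ genSpan 𝕜 b * colSpan 𝕜 b k := by
  rw [colSpan, genSpan, Submodule.span_mul_span, Submodule.span_le]
  rintro _ ⟨_, ⟨x, rfl⟩, _, ⟨a, rfl⟩, rfl⟩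
  have hsnoc := colSpan_succ_le 𝕜 b k (columnOp_mem_colSpan 𝕜 b (Fin.snoc x a))
  have hsum : columnOp b x * b a + (-1 : ℤ) ^ k • (b a * columnOp b x)
      ∈ genSpan 𝕜 b * colSpan 𝕜 b k := by
    refine mem_of_nsmul_mem (𝕜 := 𝕜) k.succ_ne_zero ?_
    rw [← two_smul_columnOp_snoc 𝕜 hb]
    exact nsmul_mem hsnoc 2
  have hright : (-1 : ℤ) ^ k • (b a * columnOp b x) ∈ genSpan 𝕜 b * colSpan 𝕜 b k :=
    zsmul_mem (Submodule.mul_mem_mul (mem_genSpan 𝕜 b a) (columnOp_mem_colSpan 𝕜 b x)) _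
  exact (Submodule.add_mem_iff_left _ hright).1 hsum

lemma colSpan_mul_genSpan_pow_le (hb : TripleComm b) (k d : ℕ) :
    colSpan 𝕜 b k * genSpan 𝕜 b ^ d ≤ genSpan 𝕜 b ^ d * colSpan 𝕜 b k := by
  induction d with
  | zero => simp
  | succ d ih =>
    calc colSpan 𝕜 b k * genSpan 𝕜 b ^ (d + 1)
        = colSpan 𝕜 b k * genSpan 𝕜 b ^ d * genSpan 𝕜 b := by rw [pow_succ, mul_assoc]
      _ ≤ genSpan 𝕜 b ^ d * colSpan 𝕜 b k * genSpan 𝕜 b := by gcongr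
      _ = genSpan 𝕜 b ^ d * (colSpan 𝕜 b k * genSpan 𝕜 b) := mul_assoc _ _ _
      _ ≤ genSpan 𝕜 b ^ d * (genSpan 𝕜 b * colSpan 𝕜 b k) :=
        mul_le_mul_right (colSpan_mul_genSpan_le hb k) _
      _ = genSpan 𝕜 b ^ (d + 1) * colSpan 𝕜 b k := by rw [pow_succ, mul_assoc]

end TripleComm

/-! ### Garnir relations -/

section Sandwich

variable {𝕜 T : Type*} [CommRing 𝕜] [Ring T] [Algebra 𝕜 T] {η : T} {E : Submodule 𝕜 T}

variable (η E) in
/-- The space of the anticommutators `ηβ + βη` of `η` with the elements `β` of `E`. -/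
def anticommSpan : Submodule 𝕜 T := E.map (LinearMap.mulLeft 𝕜 η + LinearMap.mulRight 𝕜 η)

lemma commute_of_mem_anticommSpan_pow
    (hE : ∀ β ∈ E, ∀ γ ∈ E, Commute (η * β + β * η) γ) {t : ℕ} {s : T}
    (hs : s ∈ anticommSpan η E ^ t) {γ : T} (hγ : γ ∈ E) : Commute s γ := by
  induction hs using Submodule.pow_induction_on_left' with
  | algebraMap r => exact Algebra.commutes r γ
  | add _ _ _ _ _ h h' => exact h.add_left h'
  | mem_mul _ hm _ _ _ h =>
    obtain ⟨β, hβ, rfl⟩ := hm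
    exact (hE β hβ γ hγ).mul_left h

lemma pow_succ_mul_of_anticomm {β : T}
    (hη : η * (η * β + β * η) = -((η * β + β * η) * η)) (k : ℕ) :
    η ^ (k + 1) * β = (-1 : ℤ) ^ (k + 1) • (β * η ^ (k + 1))
      + ((k + 1) * (-1 : ℤ) ^ k) • ((η * β + β * η) * η ^ k) :=
  pow_mul_of_qCommute (by simp) (by simpa using hη) k

end Sandwich

section Sandwich

variable {𝕜 T : Type*} [Field 𝕜] [CharZero 𝕜] [Ring T] [Algebra 𝕜 T] {η : T}
  {E : Submodule 𝕜 T} {J : ℕ → Submodule 𝕜 T} {m : ℕ}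

lemma mul_pow_mem_of_anticomm
    (hη : ∀ β ∈ E, η * (η * β + β * η) = -((η * β + β * η) * η))
    (hE : ∀ β ∈ E, ∀ γ ∈ E, Commute (η * β + β * η) γ)
    (hl : ∀ d, E * J d ≤ J (d + 1)) (hr : ∀ d, J d * E ≤ J (d + 1)) (h0 : η ^ m ∈ J 0)
    {t j : ℕ} {s : T} (hs : s ∈ anticommSpan η E ^ t) (hm : t + j = m) : s * η ^ j ∈ J t := by
  induction hs using Submodule.pow_induction_on_right' generalizing j with
  | algebraMap r =>
    rw [← Algebra.smul_def, ← zero_add j, hm]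
    exact Submodule.smul_mem _ _ h0
  | add _ _ _ _ _ h h' =>
    rw [add_mul]
    exact add_mem (h hm) (h' hm)
  | mul_mem t s hs ih _ hβ =>
    obtain ⟨β, hβ, rfl⟩ := hβ
    have hz : s * η ^ (j + 1) ∈ J t := ih (by omega)
    have hsβ : s * (β * η ^ (j + 1)) = β * (s * η ^ (j + 1)) := by
      rw [← mul_assoc, (commute_of_mem_anticommSpan_pow hE hs hβ).eq, mul_assoc]
    have hsum : s * (η ^ (j + 1) * β) ∈ J (t + 1) := by
      rw [← mul_assoc]
      exact hr t (Submodule.mul_mem_mul hz hβ)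
    rw [pow_succ_mul_of_anticomm (hη β hβ), mul_add, mul_smul_comm, hsβ,
      Submodule.add_mem_iff_right _ (zsmul_mem (hl t (Submodule.mul_mem_mul hβ hz)) _),
      mul_smul_comm, ← Int.cast_smul_eq_zsmul 𝕜, Submodule.smul_mem_iff, ← mul_assoc] at hsum
    · exact hsum
    · push_cast
      exact mul_ne_zero (Nat.cast_add_one_ne_zero j) (pow_ne_zero _ (neg_ne_zero.2 one_ne_zero))

/-- Pushing a factor `β` of `w` to the left through `ηᵏ` either leaves it in front or trades it,
with one factor `η`, for the even element `ηβ + βη`, which can be moved to the far left. -/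
lemma pow_mul_mul_pow_mem_of_anticomm
    (hη : ∀ β ∈ E, η * (η * β + β * η) = -((η * β + β * η) * η))
    (hE : ∀ β ∈ E, ∀ γ ∈ E, Commute (η * β + β * η) γ)
    (hl : ∀ d, E * J d ≤ J (d + 1)) (hr : ∀ d, J d * E ≤ J (d + 1)) (h0 : η ^ m ∈ J 0)
    {d k l : ℕ} {w : T} (hw : w ∈ E ^ d) (hm : k + l = m) : η ^ k * w * η ^ l ∈ J d := by
  suffices h : ∀ t k (s : T), s ∈ anticommSpan η E ^ t → t + k + l = m →
      s * η ^ k * w * η ^ l ∈ J (t + d) by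
    simpa using h 0 k 1 (Submodule.one_le.1 (pow_zero _).ge) (by omega)
  clear hm
  induction hw using Submodule.pow_induction_on_left' with
  | algebraMap r =>
    intro t k s hs hm
    rw [← Algebra.commutes, ← Algebra.smul_def, smul_mul_assoc, mul_assoc, ← pow_add]
    exact Submodule.smul_mem _ _ (mul_pow_mem_of_anticomm hη hE hl hr h0 hs (by omega))
  | add _ _ _ _ _ h h' =>
    intro t k s hs hm
    rw [mul_add, add_mul]
    exact add_mem (h t k s hs hm) (h' t k s hs hm)
  | mem_mul β hβ d w _ ih =>
    intro t k s hs hm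
    have hfront : s * (β * η ^ k * w * η ^ l) ∈ J (t + (d + 1)) := by
      have := hl _ (Submodule.mul_mem_mul hβ (ih t k s hs hm))
      simpa only [← mul_assoc, (commute_of_mem_anticommSpan_pow hE hs hβ).eq, add_assoc] using this
    cases k with
    | zero => simpa [mul_assoc] using hfront
    | succ k =>
      have hS : s * (η * β + β * η) ∈ anticommSpan η E ^ (t + 1) := by
        rw [pow_succ]
        exact Submodule.mul_mem_mul hs ⟨β, hβ, rfl⟩
      have htrade := ih (t + 1) k _ hS (by omega)
      have hsplit : s * η ^ (k + 1) * (β * w) * η ^ l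
          = (-1 : ℤ) ^ (k + 1) • (s * (β * η ^ (k + 1) * w * η ^ l))
            + ((k + 1) * (-1 : ℤ) ^ k) • (s * (η * β + β * η) * η ^ k * w * η ^ l) := by
        rw [← mul_assoc, mul_assoc s, pow_succ_mul_of_anticomm (hη β hβ)]
        simp only [mul_add, add_mul, mul_smul_comm, smul_mul_assoc, mul_assoc]
      rw [hsplit]
      exact add_mem (zsmul_mem hfront _)
        (zsmul_mem (by rwa [add_right_comm, add_assoc] at htrade) _)

end Sandwich

section Garnir

open ExteriorAlgebra (ιMulti)

variable {𝕜 R V : Type*} [CommRing 𝕜] [Ring R] [Algebra 𝕜 R] [AddCommGroup V]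
  [Module 𝕜 V] {L n k l : ℕ} {b : Fin n → R}

lemma commute_of_mem_genSpan (hb : TripleComm b) (i : Fin n) {w u : R} (hw : w ∈ genSpan 𝕜 b)
    (hu : u ∈ genSpan 𝕜 b) : Commute (b i * w + w * b i) u := by
  induction hw, hu using Submodule.span_induction₂ with
  | mem_mem w u hw hu =>
    obtain ⟨j, rfl⟩ := hw
    obtain ⟨a, rfl⟩ := hu
    exact hb i j a
  | zero_left => simp
  | zero_right => simp
  | add_left w w' u _ _ _ h h' =>
    rw [mul_add, add_mul, add_add_add_comm]
    exact h.add_left h'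
  | add_right _ _ _ _ _ _ h h' => exact h.add_right h'
  | smul_left c _ _ _ _ h =>
    rw [mul_smul_comm, smul_mul_assoc, ← smul_add]
    exact h.smul_left c
  | smul_right c _ _ _ _ h => exact h.smul_right c

lemma eta_anticomm_tmul_one (x : Fin L → Fin n) (v : Fin L → V) (w : R) :
    eta 𝕜 (b ∘ x) v * (w ⊗ₜ[𝕜] 1) + (w ⊗ₜ[𝕜] 1) * eta 𝕜 (b ∘ x) v
      = ∑ i, (b (x i) * w + w * b (x i)) ⊗ₜ[𝕜] ExteriorAlgebra.ι 𝕜 (v i) := by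
  simp [eta, Finset.sum_mul, Finset.mul_sum, TensorProduct.add_tmul, Finset.sum_add_distrib]

lemma eta_mul_anticomm (hb : TripleComm b) (x : Fin L → Fin n) (v : Fin L → V) {w : R}
    (hw : w ∈ genSpan 𝕜 b) :
    eta 𝕜 (b ∘ x) v * (eta 𝕜 (b ∘ x) v * (w ⊗ₜ[𝕜] 1) + (w ⊗ₜ[𝕜] 1) * eta 𝕜 (b ∘ x) v)
      = -((eta 𝕜 (b ∘ x) v * (w ⊗ₜ[𝕜] 1) + (w ⊗ₜ[𝕜] 1) * eta 𝕜 (b ∘ x) v)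
          * eta 𝕜 (b ∘ x) v) := by
  rw [eta_anticomm_tmul_one, eta, Finset.sum_mul_sum, Finset.sum_mul_sum, Finset.sum_comm,
    ← Finset.sum_neg_distrib]
  refine Finset.sum_congr rfl fun i _ => ?_
  rw [← Finset.sum_neg_distrib]
  refine Finset.sum_congr rfl fun j _ => ?_
  rw [Algebra.TensorProduct.tmul_mul_tmul, Algebra.TensorProduct.tmul_mul_tmul, ι_mul_ι (v j),
    TensorProduct.tmul_neg, Function.comp_apply,
    (commute_of_mem_genSpan hb (x i) hw (mem_genSpan 𝕜 b (x j))).eq]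

lemma commute_anticomm_tmul_one (hb : TripleComm b) (x : Fin L → Fin n) (v : Fin L → V)
    {w u : R} (hw : w ∈ genSpan 𝕜 b) (hu : u ∈ genSpan 𝕜 b) :
    Commute (eta 𝕜 (b ∘ x) v * (w ⊗ₜ[𝕜] 1) + (w ⊗ₜ[𝕜] 1) * eta 𝕜 (b ∘ x) v) (u ⊗ₜ[𝕜] 1) := by
  rw [eta_anticomm_tmul_one]
  refine Commute.sum_left _ _ _ fun i _ => ?_
  rw [Commute, SemiconjBy, Algebra.TensorProduct.tmul_mul_tmul,
    Algebra.TensorProduct.tmul_mul_tmul, (commute_of_mem_genSpan hb _ hw hu).eq, one_mul, mul_one]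

lemma factorial_smul_eta_pow_mul_mul_eta_pow (x : Fin L → Fin n) (v : Fin L → V) (w : R) :
    (k.factorial * l.factorial) • (eta 𝕜 (b ∘ x) v ^ k * (w ⊗ₜ[𝕜] 1) * eta 𝕜 (b ∘ x) v ^ l)
      = ∑ f : Fin (k + l) → Fin L, (columnOp b (x ∘ f ∘ Fin.castAdd l) * w
          * columnOp b (x ∘ f ∘ Fin.natAdd k)) ⊗ₜ[𝕜] ιMulti 𝕜 (k + l) (v ∘ f) := by
  calc _ = k.factorial • eta 𝕜 (b ∘ x) v ^ k * (w ⊗ₜ[𝕜] 1)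
        * l.factorial • eta 𝕜 (b ∘ x) v ^ l := by
        simp only [smul_mul_assoc, mul_smul_comm, smul_smul, mul_comm]
    _ = ∑ f : (Fin k → Fin L) × (Fin l → Fin L),
        (columnOp (b ∘ x) f.1 * w * columnOp (b ∘ x) f.2)
          ⊗ₜ[𝕜] (ιMulti 𝕜 k (v ∘ f.1) * ιMulti 𝕜 l (v ∘ f.2)) := by
        simp only [factorial_smul_eta_pow, Finset.sum_mul, Finset.mul_sum,
          Algebra.TensorProduct.tmul_mul_tmul, mul_one, Fintype.sum_prod_type]
        exact Finset.sum_comm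
    _ = _ := by
        refine Fintype.sum_equiv (Fin.appendEquiv k l) _ _ fun f => ?_
        have hleft : Fin.append f.1 f.2 ∘ Fin.castAdd l = f.1 := funext fun i => by simp
        have hright : Fin.append f.1 f.2 ∘ Fin.natAdd k = f.2 := funext fun i => by simp
        have hcomp : v ∘ Fin.append f.1 f.2 = Fin.append (v ∘ f.1) (v ∘ f.2) :=
          funext fun i => by refine Fin.addCases (fun i => ?_) (fun i => ?_) i <;> simp
        change _ = (columnOp b (x ∘ Fin.append f.1 f.2 ∘ Fin.castAdd l) * w
          * columnOp b (x ∘ Fin.append f.1 f.2 ∘ Fin.natAdd k))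
            ⊗ₜ[𝕜] ιMulti 𝕜 _ (v ∘ Fin.append _ _)
        rw [hleft, hright, ExteriorAlgebra.ιMulti_mul_ιMulti, hcomp]
        rfl

end Garnir

section Garnir

variable {𝕜 R V : Type*} [Field 𝕜] [CharZero 𝕜] [Ring R] [Algebra 𝕜 R] [AddCommGroup V]
  [Module 𝕜 V] {L n k l : ℕ} {b : Fin n → R}

lemma eta_pow_mul_mul_eta_pow_mem (hb : TripleComm b) (x : Fin L → Fin n) (v : Fin L → V)
    {d : ℕ} {w : R} (hw : w ∈ genSpan 𝕜 b ^ d) :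
    eta 𝕜 (b ∘ x) v ^ k * (w ⊗ₜ[𝕜] 1) * eta 𝕜 (b ∘ x) v ^ l
      ∈ env V (genSpan 𝕜 b ^ d * colSpan 𝕜 b (k + l)) := by
  let incl : R →ₐ[𝕜] R ⊗[𝕜] ExteriorAlgebra 𝕜 V := Algebra.TensorProduct.includeLeft
  have hincl : (genSpan 𝕜 b).map incl.toLinearMap ≤ env V (genSpan 𝕜 b) := by
    rintro _ ⟨w, hw, rfl⟩
    exact tmul_mem_env hw 1
  refine pow_mul_mul_pow_mem_of_anticomm (E := (genSpan 𝕜 b).map incl.toLinearMap)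
    (J := fun d => env V (genSpan 𝕜 b ^ d * colSpan 𝕜 b (k + l))) ?_ ?_ (fun d => ?_)
    (fun d => ?_) ?_ ?_ rfl
  · rintro _ ⟨w, hw, rfl⟩
    exact eta_mul_anticomm hb x v hw
  · rintro _ ⟨w, hw, rfl⟩ _ ⟨u, hu, rfl⟩
    exact commute_anticomm_tmul_one hb x v hw hu
  · rw [pow_succ', mul_assoc]
    exact (mul_le_mul_left hincl _).trans (env_mul_le _ _)
  · refine (mul_le_mul_right hincl _).trans ((env_mul_le _ _).trans (env_mono ?_))
    rw [mul_assoc, pow_succ, mul_assoc]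
    exact mul_le_mul_right (colSpan_mul_genSpan_le hb _) _
  · simpa using eta_pow_mem_env b x v (k + l)
  · rw [← Submodule.map_pow]
    exact ⟨w, hw, rfl⟩

lemma sum_sign_columnOp_mul_mul_columnOp_mem (hb : TripleComm b) (x : Fin (k + l) → Fin n)
    {d : ℕ} {w : R} (hw : w ∈ genSpan 𝕜 b ^ d) :
    ∑ σ : Equiv.Perm (Fin (k + l)), Equiv.Perm.sign σ •
        (columnOp b (x ∘ σ ∘ Fin.castAdd l) * w * columnOp b (x ∘ σ ∘ Fin.natAdd k))
      ∈ genSpan 𝕜 b ^ d * colSpan 𝕜 b (k + l) := by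
  apply mem_of_tmul_topForm_mem_env (𝕜 := 𝕜) (m := k + l)
  rw [topForm, ← sum_tmul_ιMulti fun f => columnOp b (x ∘ f ∘ Fin.castAdd l) * w *
    columnOp b (x ∘ f ∘ Fin.natAdd k), ← factorial_smul_eta_pow_mul_mul_eta_pow]
  exact nsmul_mem (eta_pow_mul_mul_eta_pow_mem hb x _ hw) _

end Garnir

section GarnirSum

variable {R : Type*} [Ring R] {n k l s s' : ℕ} {b : Fin n → R}

/-- The antisymmetrisation over the entries `x` of the product of two columns, with entries `x`
and `c`, respectively `x` and `c'`, separated by a factor `w`. -/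
def garnirSum (b : Fin n → R) (x : Fin k ⊕ Fin l → Fin n) (c : Fin s → Fin n)
    (c' : Fin s' → Fin n) (w : R) : R :=
  ∑ σ : Equiv.Perm (Fin k ⊕ Fin l), Equiv.Perm.sign σ •
    (columnOp b (Fin.append (x ∘ σ ∘ Sum.inl) c) * w * columnOp b (Fin.append (x ∘ σ ∘ Sum.inr) c'))

variable (𝕜 : Type*) [CommRing 𝕜] [Algebra 𝕜 R]

include 𝕜 in
lemma two_smul_garnirSum_snoc_left (hb : TripleComm b) (x : Fin k ⊕ Fin l → Fin n)
    (c : Fin s → Fin n) (c' : Fin s' → Fin n) (a : Fin n) (w : R) :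
    2 • garnirSum b x (Fin.snoc c a : Fin (s + 1) → Fin n) c' w
      = (k + s + 1) • (garnirSum b x c c' (b a * w)
        + (-1 : ℤ) ^ (k + s) • (b a * garnirSum b x c c' w)) := by
  simp only [garnirSum, Finset.smul_sum, Finset.mul_sum, ← Finset.sum_add_distrib]
  refine Finset.sum_congr rfl fun σ _ => ?_
  rw [Fin.append_snoc, smul_comm, mul_assoc, ← smul_mul_assoc, two_smul_columnOp_snoc 𝕜 hb]
  simp only [smul_mul_assoc, mul_smul_comm, add_mul, smul_add, mul_assoc,
    smul_comm (Equiv.Perm.sign σ), Nat.add_eq]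

include 𝕜 in
lemma two_smul_garnirSum_snoc_right (hb : TripleComm b) (x : Fin k ⊕ Fin l → Fin n)
    (c : Fin s → Fin n) (c' : Fin s' → Fin n) (a : Fin n) (w : R) :
    2 • garnirSum b x c (Fin.snoc c' a : Fin (s' + 1) → Fin n) w
      = (l + s' + 1) • (garnirSum b x c c' w * b a
        + (-1 : ℤ) ^ (l + s') • garnirSum b x c c' (w * b a)) := by
  simp only [garnirSum, Finset.smul_sum, Finset.sum_mul, ← Finset.sum_add_distrib]
  refine Finset.sum_congr rfl fun σ _ => ?_
  rw [Fin.append_snoc, smul_comm, ← mul_smul_comm, two_smul_columnOp_snoc 𝕜 hb]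
  simp only [smul_mul_assoc, mul_smul_comm, mul_add, smul_add, mul_assoc,
    smul_comm (Equiv.Perm.sign σ), Nat.add_eq]

end GarnirSum

section GarnirSum

variable {𝕜 R : Type*} [Field 𝕜] [CharZero 𝕜] [Ring R] [Algebra 𝕜 R] {n k l s s' d : ℕ}
  {b : Fin n → R} {w : R}

lemma garnirSum_zero_mem (hb : TripleComm b) (x : Fin k ⊕ Fin l → Fin n) (c c' : Fin 0 → Fin n)
    (hw : w ∈ genSpan 𝕜 b ^ d) :
    garnirSum b x c c' w ∈ genSpan 𝕜 b ^ d * colSpan 𝕜 b (k + l) := by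
  convert sum_sign_columnOp_mul_mul_columnOp_mem hb (x ∘ finSumFinEquiv.symm) hw using 1
  refine Fintype.sum_equiv finSumFinEquiv.permCongr _ _ fun σ => ?_
  have hinl : Fin.append (x ∘ σ ∘ Sum.inl) c
      = (x ∘ finSumFinEquiv.symm) ∘ finSumFinEquiv.permCongr σ ∘ Fin.castAdd l := by
    rw [Subsingleton.elim c Fin.elim0, Fin.append_elim0]
    ext i
    simp
  have hinr : Fin.append (x ∘ σ ∘ Sum.inr) c'
      = (x ∘ finSumFinEquiv.symm) ∘ finSumFinEquiv.permCongr σ ∘ Fin.natAdd k := by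
    rw [Subsingleton.elim c' Fin.elim0, Fin.append_elim0]
    ext i
    simp
  rw [Equiv.Perm.sign_permCongr, hinl, hinr]

lemma garnirSum_zero_left_mem (hb : TripleComm b) (x : Fin k ⊕ Fin l → Fin n) (c : Fin 0 → Fin n)
    (c' : Fin s' → Fin n) (hw : w ∈ genSpan 𝕜 b ^ d) :
    garnirSum b x c c' w ∈ genSpan 𝕜 b ^ (d + s') * colSpan 𝕜 b (k + l) := by
  induction s' generalizing d w with
  | zero => exact garnirSum_zero_mem hb x c c' hw
  | succ s' ih =>
    rw [← Fin.snoc_init_self c']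
    refine mem_of_nsmul_mem (𝕜 := 𝕜) two_ne_zero ?_
    rw [two_smul_garnirSum_snoc_right 𝕜 hb]
    refine nsmul_mem (add_mem ?_ (zsmul_mem ?_ _)) _
    · have h := Submodule.mul_mem_mul (ih (Fin.init c') hw) (mem_genSpan 𝕜 b (c' (Fin.last s')))
      rw [mul_assoc] at h
      rw [← add_assoc, pow_succ, mul_assoc]
      exact mul_le_mul_right (colSpan_mul_genSpan_le hb _) _ h
    · rw [← add_assoc, add_right_comm]
      refine ih _ ?_
      rw [pow_succ]
      exact Submodule.mul_mem_mul hw (mem_genSpan 𝕜 b _)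

theorem garnirSum_mem (hb : TripleComm b) (x : Fin k ⊕ Fin l → Fin n) (c : Fin s → Fin n)
    (c' : Fin s' → Fin n) (hw : w ∈ genSpan 𝕜 b ^ d) :
    garnirSum b x c c' w ∈ genSpan 𝕜 b ^ (s + d + s') * colSpan 𝕜 b (k + l) := by
  induction s generalizing d w with
  | zero => simpa using garnirSum_zero_left_mem hb x c c' hw
  | succ s ih =>
    rw [← Fin.snoc_init_self c]
    refine mem_of_nsmul_mem (𝕜 := 𝕜) two_ne_zero ?_
    rw [two_smul_garnirSum_snoc_left 𝕜 hb]
    refine nsmul_mem (add_mem ?_ (zsmul_mem ?_ _)) _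
    · rw [add_assoc s 1, add_comm 1]
      refine ih _ ?_
      rw [pow_succ']
      exact Submodule.mul_mem_mul (mem_genSpan 𝕜 b _) hw
    · rw [add_right_comm s, add_right_comm _ 1, pow_succ', mul_assoc]
      exact Submodule.mul_mem_mul (mem_genSpan 𝕜 b _) (ih _ hw)

end GarnirSum

/-! ### Straightening -/

section Exchange

variable {M : Type*} [AddCommMonoid M] [PartialOrder M] [IsOrderedCancelAddMonoid M]

lemma sum_lt_sum_of_card_eq {α : Type*} {S T : Finset α} {f : α → M} (hcard : S.card = T.card)
    (hne : S ≠ T) (hf : ∀ a ∉ T, ∀ a' ∈ T, f a < f a') : ∑ a ∈ S, f a < ∑ a ∈ T, f a := by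
  classical
  obtain ⟨e⟩ : Nonempty ((S \ T : Finset α) ≃ (T \ S : Finset α)) :=
    ⟨Finset.equivOfCardEq (Finset.card_sdiff_comm hcard)⟩
  have hnonempty : (S \ T).Nonempty :=
    Finset.sdiff_nonempty.2 fun h => hne (Finset.eq_of_subset_of_card_le h hcard.ge)
  rw [← Finset.sum_inter_add_sum_sdiff S T, ← Finset.sum_inter_add_sum_sdiff T S,
    Finset.inter_comm T S]
  refine add_lt_add_right ?_ _
  rw [← Finset.sum_coe_sort, ← Finset.sum_coe_sort (T \ S), ← e.sum_comp]
  exact Finset.sum_lt_sum_of_nonempty (by simpa using hnonempty) fun a _ =>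
    hf _ (Finset.mem_sdiff.1 a.2).2 _ (Finset.mem_sdiff.1 (e a).2).1

lemma sum_comp_perm_inr_lt {α β : Type*} [Fintype β] {f : α ⊕ β → M}
    (hf : ∀ i j, f (Sum.inl i) < f (Sum.inr j)) {σ : Equiv.Perm (α ⊕ β)}
    (hσ : ¬ Set.MapsTo σ (Set.range Sum.inl) (Set.range Sum.inl)) :
    ∑ j, f (σ (Sum.inr j)) < ∑ j, f (Sum.inr j) := by
  let T : Finset (α ⊕ β) := Finset.univ.map Function.Embedding.inr
  have hT (a : α ⊕ β) : a ∈ T ↔ a ∉ Set.range Sum.inl := by cases a <;> simp [T]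
  have hlt : ∑ a ∈ T.map σ.toEmbedding, f a < ∑ a ∈ T, f a := by
    refine sum_lt_sum_of_card_eq (Finset.card_map _) (fun h => hσ fun a ha => ?_)
      fun a ha a' ha' => ?_
    · by_contra hσa
      rw [← hT, ← h, Finset.mem_map_equiv, Equiv.symm_apply_apply, hT] at hσa
      exact hσa ha
    · rw [hT, not_not] at ha
      obtain ⟨i, rfl⟩ := ha
      obtain ⟨j, -, rfl⟩ := Finset.mem_map.1 ha'
      exact hf i j
  simpa [T] using hlt

end Exchange

section Straightening

section ColumnOp

variable {R : Type*} [Ring R] {n k l : ℕ} (b : Fin n → R)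

lemma columnOp_append_comp_perm (u : Fin k → Fin n) (c : Fin l → Fin n) (π : Equiv.Perm (Fin k)) :
    columnOp b (Fin.append (u ∘ π) c) = Equiv.Perm.sign π • columnOp b (Fin.append u c) := by
  have hcomp : Fin.append (u ∘ π) c
      = Fin.append u c ∘ finSumFinEquiv.permCongr (Equiv.Perm.sumCongr π 1) :=
    funext fun i => by refine Fin.addCases (fun i => ?_) (fun i => ?_) i <;> simp
  rw [hcomp, columnOp_comp_perm, Equiv.Perm.sign_permCongr, Equiv.Perm.sign_sumCongr, map_one,
    mul_one]

lemma exists_columnOp_append_flip :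
    ∃ ε : ℤˣ, ∀ (u : Fin k → Fin n) (c : Fin l → Fin n),
      columnOp b (Fin.append c u) = ε • columnOp b (Fin.append u c) := by
  obtain ⟨ε, hε⟩ := exists_columnOp_comp_equiv b (finAddFlip : Fin (l + k) ≃ Fin (k + l))
  refine ⟨ε, fun u c => ?_⟩
  have hcomp : Fin.append c u = Fin.append u c ∘ finAddFlip :=
    funext fun i => by refine Fin.addCases (fun i => ?_) (fun i => ?_) i <;> simp
  rw [hcomp, hε]

end ColumnOp

section ColSpanLT

variable {𝕜 R : Type*} [CommRing 𝕜] [Ring R] [Algebra 𝕜 R] {n k : ℕ} {b : Fin n → R}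

variable (𝕜 b) in
/-- The span of the strictly increasing columns of length `k` with sum of entries less than `N`. -/
def colSpanLT (k N : ℕ) : Submodule 𝕜 R :=
  Submodule.span 𝕜 {z | ∃ K : Fin k → Fin n, StrictMono K ∧ ∑ j, (K j : ℕ) < N ∧ columnOp b K = z}

lemma colSpanLT_mono {N N' : ℕ} (h : N ≤ N') : colSpanLT 𝕜 b k N ≤ colSpanLT 𝕜 b k N' :=
  Submodule.span_mono fun _ ⟨K, hK, hN, hz⟩ => ⟨K, hK, hN.trans_le h, hz⟩

lemma columnOp_mem_colSpanLT {K : Fin k → Fin n} {N : ℕ} (hN : ∑ j, (K j : ℕ) < N) :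
    columnOp b K ∈ colSpanLT 𝕜 b k N := by
  by_cases hinj : Function.Injective K
  · let τ := Tuple.sort K
    have hsort : columnOp b K = Equiv.Perm.sign τ⁻¹ • columnOp b (K ∘ τ) := by
      rw [← columnOp_comp_perm, Function.comp_assoc, ← Equiv.Perm.coe_mul, mul_inv_cancel,
        Equiv.Perm.coe_one, Function.comp_id]
    have hmem : columnOp b (K ∘ τ) ∈ colSpanLT 𝕜 b k N := by
      refine Submodule.subset_span ⟨K ∘ τ, ?_, ?_, rfl⟩
      · exact (Tuple.monotone_sort K).strictMono_of_injective (hinj.comp τ.injective)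
      · exact (Equiv.sum_comp τ fun j => (K j : ℕ)).trans_lt hN
    rw [hsort]
    exact zsmul_mem hmem _
  · rw [columnOp_eq_zero_of_not_injective b hinj]
    exact zero_mem _

end ColSpanLT

variable {𝕜 R : Type*} [Field 𝕜] [CharZero 𝕜] [Ring R] [Algebra 𝕜 R] {n k l s s' : ℕ}
  {b : Fin n → R}

/-- In the Garnir relation on `u` and `y`, the permutations preserving the two blocks all
contribute the product on the left, while the other ones move a smaller entry of `u` into the
second column. -/
lemma columnOp_append_mul_columnOp_append_mem (hb : TripleComm b) {u : Fin k → Fin n}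
    {y : Fin l → Fin n} (huy : ∀ i j, u i < y j) (c : Fin s → Fin n) (c' : Fin s' → Fin n) :
    columnOp b (Fin.append u c) * columnOp b (Fin.append y c')
      ∈ genSpan 𝕜 b ^ (s + s') * colSpan 𝕜 b (k + l)
        ⊔ colSpan 𝕜 b (k + s) * colSpanLT 𝕜 b (l + s') (∑ j, (y j : ℕ) + ∑ j, (c' j : ℕ)) := by
  classical
  set W := genSpan 𝕜 b ^ (s + s') * colSpan 𝕜 b (k + l)
    ⊔ colSpan 𝕜 b (k + s) * colSpanLT 𝕜 b (l + s') (∑ j, (y j : ℕ) + ∑ j, (c' j : ℕ))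
  let x : Fin k ⊕ Fin l → Fin n := Sum.elim u y
  let term (σ : Equiv.Perm (Fin k ⊕ Fin l)) : R := Equiv.Perm.sign σ •
    (columnOp b (Fin.append (x ∘ σ ∘ Sum.inl) c) * 1 * columnOp b (Fin.append (x ∘ σ ∘ Sum.inr) c'))
  let blocks : Finset (Equiv.Perm (Fin k ⊕ Fin l)) :=
    {σ | Set.MapsTo σ (Set.range Sum.inl) (Set.range Sum.inl)}
  have hblock : ∀ σ ∈ blocks,
      term σ = columnOp b (Fin.append u c) * columnOp b (Fin.append y c') := by
    intro σ hσ
    obtain ⟨⟨π, ρ⟩, rfl⟩ := Equiv.Perm.mem_sumCongrHom_range_of_perm_mapsTo_inl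
      (Finset.mem_filter.1 hσ).2
    have hinl : x ∘ Equiv.Perm.sumCongr π ρ ∘ Sum.inl = u ∘ π := rfl
    have hinr : x ∘ Equiv.Perm.sumCongr π ρ ∘ Sum.inr = y ∘ ρ := rfl
    simp only [term, Equiv.Perm.sumCongrHom_apply, hinl, hinr, columnOp_append_comp_perm,
      Equiv.Perm.sign_sumCongr, mul_one, smul_mul_smul_comm, smul_smul, Int.units_mul_self,
      one_smul]
  have hother : ∀ σ ∉ blocks, term σ ∈ W := by
    intro σ hσ
    simp only [term, mul_one]
    refine Submodule.mem_sup_right (zsmul_mem (Submodule.mul_mem_mul (columnOp_mem_colSpan 𝕜 b _)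
      (columnOp_mem_colSpanLT ?_)) _)
    simp only [Fin.sum_univ_add, Fin.append_left, Fin.append_right, Function.comp_apply]
    refine add_lt_add_left (sum_comp_perm_inr_lt (f := fun i => (x i : ℕ)) huy fun h => ?_) _
    exact hσ (Finset.mem_filter.2 ⟨Finset.mem_univ σ, h⟩)
  have htotal : ∑ σ, term σ ∈ W := Submodule.mem_sup_left
    (garnirSum_mem (d := 0) hb x c c' (Submodule.one_le.1 (pow_zero _).ge))
  rw [← Finset.sum_add_sum_compl blocks, Submodule.add_mem_iff_left _ (Submodule.sum_mem _
    fun σ hσ => hother σ (Finset.mem_compl.1 hσ)), Finset.sum_congr rfl hblock,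
    Finset.sum_const] at htotal
  refine mem_of_nsmul_mem (𝕜 := 𝕜) (Finset.card_ne_zero.2 ⟨1, ?_⟩) htotal
  exact Finset.mem_filter.2 ⟨Finset.mem_univ 1, Set.mapsTo_id _⟩

lemma columnOp_mul_columnOp_mem_of_lt (hb : TripleComm b) {r : ℕ} {I : Fin (r + 1 + s) → Fin n}
    {K : Fin (r + l) → Fin n} (hI : StrictMono I) (hK : StrictMono K) (hl : 0 < l)
    (hlt : I (Fin.castAdd s (Fin.last r)) < K (Fin.natAdd r ⟨0, hl⟩)) :
    columnOp b I * columnOp b K ∈ genSpan 𝕜 b ^ (s + r) * colSpan 𝕜 b (r + 1 + l)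
      ⊔ colSpan 𝕜 b (r + 1 + s) * colSpanLT 𝕜 b (r + l) (∑ j, (K j : ℕ)) := by
  obtain ⟨ε, hε⟩ := exists_columnOp_append_flip (k := l) (l := r) b
  have hlt' (i : Fin (r + 1)) (j : Fin l) : I (Fin.castAdd s i) < K (Fin.natAdd r j) :=
    calc I (Fin.castAdd s i) ≤ I (Fin.castAdd s (Fin.last r)) :=
          hI.monotone (Fin.le_def.2 (Fin.le_last i))
      _ < K (Fin.natAdd r ⟨0, hl⟩) := hlt
      _ ≤ K (Fin.natAdd r j) := hK.monotone (Fin.le_def.2 (by simp))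
  have h := columnOp_append_mul_columnOp_append_mem (𝕜 := 𝕜) hb hlt'
    (I ∘ Fin.natAdd (r + 1)) (K ∘ Fin.castAdd l)
  have hsum : ∑ j, (K (Fin.natAdd r j) : ℕ) + ∑ j, (K (Fin.castAdd l j) : ℕ) = ∑ j, (K j : ℕ) := by
    rw [Fin.sum_univ_add, add_comm]
  have hdim (N : ℕ) : colSpanLT 𝕜 b (l + r) N = colSpanLT 𝕜 b (r + l) N := by rw [add_comm]
  have hcolI : columnOp b I = columnOp b
      (Fin.append (fun i => I (Fin.castAdd s i)) (I ∘ Fin.natAdd (r + 1))) :=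
    congrArg _ (Fin.append_castAdd_natAdd (f := I)).symm
  have hcolK : columnOp b K = ε • columnOp b
      (Fin.append (fun j => K (Fin.natAdd r j)) (K ∘ Fin.castAdd l)) := by
    rw [← hε]
    exact congrArg _ (Fin.append_castAdd_natAdd (f := K)).symm
  simp only [Function.comp_apply] at h
  rw [hsum, hdim] at h
  rw [hcolI, hcolK, mul_smul_comm]
  exact zsmul_mem h _

end Straightening

namespace Tableau

variable {n : ℕ}

/-- The number of boxes. -/
def size (A : Tableau n) : ℕ := ∑ l ∈ Finset.range A.cols, A.shape.colLen l

/-- The empty tableau. -/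
def empty (n : ℕ) : Tableau n where
  shape := ⊥
  filling := ⟨fun _ _ => 0, fun _ h => absurd h (YoungDiagram.notMem_bot _),
    fun _ h => absurd h (YoungDiagram.notMem_bot _), fun _ => rfl⟩
  entry_lt h := absurd h (YoungDiagram.notMem_bot _)

lemma cols_pos_iff (A : Tableau n) : 0 < A.cols ↔ 0 < A.rows := by
  rw [cols, rows, ← YoungDiagram.mem_iff_lt_rowLen, ← YoungDiagram.mem_iff_lt_colLen]

lemma cols_empty : (empty n).cols = 0 := by
  by_contra h
  exact YoungDiagram.notMem_bot (0, 0)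
    (YoungDiagram.mem_iff_lt_rowLen.2 (Nat.pos_of_ne_zero h) : (0, 0) ∈ (⊥ : YoungDiagram))

lemma size_empty : (empty n).size = 0 := by simp [size, cols_empty]

lemma colLen_le_rows (A : Tableau n) (l : ℕ) : A.shape.colLen l ≤ A.rows :=
  A.shape.colLen_anti 0 l (Nat.zero_le l)

lemma col_strictMono (A : Tableau n) (l : ℕ) : StrictMono (A.col l) := fun _ s hrs =>
  Fin.lt_def.2 (A.filling.col_strict hrs (YoungDiagram.mem_iff_lt_colLen.2 s.isLt))

lemma rows_le (A : Tableau n) : A.rows ≤ n := by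
  simpa [rows] using Fintype.card_le_of_injective _ (A.col_strictMono 0).injective

section ConsShape

/-- The Young diagram obtained by adding a first column of length `k`. -/
def consShape (μ : YoungDiagram) (k : ℕ) (h : μ.colLen 0 ≤ k) : YoungDiagram where
  cells := (Finset.range k).image (fun r => (r, 0)) ∪ μ.cells.image fun c => (c.1, c.2 + 1)
  isLowerSet := by
    rintro ⟨r, l⟩ ⟨r', l'⟩ ⟨hr, hl⟩ hmem
    simp only at hr hl
    simp only [Finset.coe_union, Finset.coe_image, Finset.coe_range,
      Set.mem_union, Set.mem_image, Set.mem_Iio, Prod.mk.injEq, Finset.mem_coe,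
      YoungDiagram.mem_cells, Prod.exists] at hmem ⊢
    rcases hmem with ⟨s, hs, rfl, rfl⟩ | ⟨s, t, hst, rfl, rfl⟩
    · exact Or.inl ⟨r', by omega, rfl, by omega⟩
    · rcases l' with _ | l'
      · refine Or.inl ⟨r', lt_of_lt_of_le ?_ h, rfl, rfl⟩
        exact YoungDiagram.mem_iff_lt_colLen.1 (μ.up_left_mem hr (Nat.zero_le t) hst)
      · exact Or.inr ⟨r', l', μ.up_left_mem hr (by omega) hst, rfl, rfl⟩

variable {μ : YoungDiagram} {k : ℕ} {h : μ.colLen 0 ≤ k}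

lemma mk_zero_mem_consShape {r : ℕ} : (r, 0) ∈ consShape μ k h ↔ r < k := by
  rw [← YoungDiagram.mem_cells]
  simp [consShape]

lemma mk_succ_mem_consShape {r l : ℕ} : (r, l + 1) ∈ consShape μ k h ↔ (r, l) ∈ μ := by
  rw [← YoungDiagram.mem_cells]
  simp [consShape]

lemma colLen_consShape_zero : (consShape μ k h).colLen 0 = k :=
  eq_of_forall_lt_iff fun r => by rw [← YoungDiagram.mem_iff_lt_colLen, mk_zero_mem_consShape]

lemma colLen_consShape_succ {l : ℕ} : (consShape μ k h).colLen (l + 1) = μ.colLen l :=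
  eq_of_forall_lt_iff fun r => by
    rw [← YoungDiagram.mem_iff_lt_colLen, mk_succ_mem_consShape, YoungDiagram.mem_iff_lt_colLen]

lemma rowLen_consShape_zero (hk : 0 < k) : (consShape μ k h).rowLen 0 = μ.rowLen 0 + 1 := by
  refine eq_of_forall_lt_iff fun l => ?_
  rw [← YoungDiagram.mem_iff_lt_rowLen]
  cases l with
  | zero => simp [mk_zero_mem_consShape, hk]
  | succ l => rw [mk_succ_mem_consShape, YoungDiagram.mem_iff_lt_rowLen, Nat.add_lt_add_iff_right]

end ConsShape

section Cons

variable (A : Tableau n) {k : ℕ} (K : Fin k → Fin n) (hK : StrictMono K) (h : A.shape.colLen 0 ≤ k)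
  (hle : ∀ r : Fin (A.shape.colLen 0), K ⟨r, r.isLt.trans_le h⟩ ≤ A.col 0 r)

/-- The tableau obtained by adding a first column. -/
def cons : Tableau n where
  shape := consShape A.shape k h
  filling :=
    { entry := fun r l => match l with
        | 0 => if hr : r < k then K ⟨r, hr⟩ else 0
        | l + 1 => A.filling r l
      row_weak' := by
        intro r l m hlm hmem
        obtain ⟨m, rfl⟩ : ∃ m', m = m' + 1 := Nat.exists_eq_add_one.2 (by omega)
        rw [mk_succ_mem_consShape] at hmem
        rcases l with _ | l
        · have hr : r < A.shape.colLen 0 :=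
            YoungDiagram.mem_iff_lt_colLen.1 (A.shape.up_left_mem le_rfl (Nat.zero_le m) hmem)
          simp only [dif_pos (hr.trans_le h)]
          exact (Fin.le_def.1 (hle ⟨r, hr⟩)).trans
            (A.filling.row_weak_of_le (Nat.zero_le m) hmem)
        · exact A.filling.row_weak (by omega) hmem
      col_strict' := by
        intro r s l hrs hmem
        rcases l with _ | l
        · rw [mk_zero_mem_consShape] at hmem
          simp only [dif_pos hmem, dif_pos (hrs.trans hmem)]
          exact hK hrs
        · exact A.filling.col_strict hrs (mk_succ_mem_consShape.1 hmem)
      zeros' := by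
        intro r l hmem
        rcases l with _ | l
        · exact dif_neg fun hr => hmem (mk_zero_mem_consShape.2 hr)
        · exact A.filling.zeros fun hA => hmem (mk_succ_mem_consShape.2 hA) }
  entry_lt := by
    intro r l hmem
    rcases l with _ | l
    · exact (dif_pos (mk_zero_mem_consShape.1 hmem)).trans_lt (Fin.isLt _)
    · exact A.entry_lt (mk_succ_mem_consShape.1 hmem)

lemma cols_cons (hk : 0 < k) : (A.cons K hK h hle).cols = A.cols + 1 :=
  rowLen_consShape_zero (h := h) hk

lemma colLen_cons_zero : (A.cons K hK h hle).shape.colLen 0 = k :=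
  colLen_consShape_zero (h := h)

lemma colLen_cons_succ (l : ℕ) : (A.cons K hK h hle).shape.colLen (l + 1) = A.shape.colLen l :=
  colLen_consShape_succ (h := h)

lemma size_cons (hk : 0 < k) : (A.cons K hK h hle).size = A.size + k := by
  rw [size, A.cols_cons K hK h hle hk, Finset.sum_range_succ', colLen_cons_zero]
  simp only [colLen_cons_succ, size]

end Cons

end Tableau

section TableauOp

variable {R : Type*} [Ring R] {n : ℕ} (b : Fin n → R) (A : Tableau n)

lemma columnOp_congr {k l : ℕ} (h : k = l) {I : Fin k → Fin n} {J : Fin l → Fin n}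
    (hIJ : ∀ r : Fin k, I r = J (Fin.cast h r)) : columnOp b I = columnOp b J := by
  subst h
  exact congrArg _ (funext hIJ)

lemma tableauOp_empty : tableauOp b (Tableau.empty n) = 1 := by
  simp [tableauOp, Tableau.cols_empty]

lemma tableauOp_eq_mul {m : ℕ} (hm : A.cols = m + 1) :
    tableauOp b A = ((List.range m).map fun l => columnOp b (A.col (l + 1))).reverse.prod
      * columnOp b (A.col 0) := by
  simp [tableauOp, hm, List.range_succ_eq_map, Function.comp_def]

lemma tableauOp_cons {k : ℕ} (hk : 0 < k) (K : Fin k → Fin n) (hK : StrictMono K)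
    (h : A.shape.colLen 0 ≤ k)
    (hle : ∀ r : Fin (A.shape.colLen 0), K ⟨r, r.isLt.trans_le h⟩ ≤ A.col 0 r) :
    tableauOp b (A.cons K hK h hle) = tableauOp b A * columnOp b K := by
  rw [tableauOp_eq_mul b _ (A.cols_cons K hK h hle hk), tableauOp]
  congr 1
  · congr 2
    exact List.map_congr_left fun l _ =>
      columnOp_congr b (A.colLen_cons_succ K hK h hle l) fun _ => rfl
  · have hlen := A.colLen_cons_zero K hK h hle
    exact columnOp_congr b hlen fun r => Fin.ext (dif_pos (r.isLt.trans_eq hlen))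

end TableauOp

section TableauSpan

lemma prod_reverse_map_range_mem {𝕜 R : Type*} [CommSemiring 𝕜] [Semiring R] [Algebra 𝕜 R]
    {W : Submodule 𝕜 R} {f : ℕ → R} {s : ℕ → ℕ} (hf : ∀ l, f l ∈ W ^ s l) (m : ℕ) :
    ((List.range m).map f).reverse.prod ∈ W ^ ∑ l ∈ Finset.range m, s l := by
  induction m with
  | zero => simpa using Submodule.one_le.1 (le_refl (1 : Submodule 𝕜 R))
  | succ m ih =>
    rw [List.range_succ, List.map_append, List.reverse_append, List.prod_append,
      Finset.sum_range_succ, add_comm, pow_add]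
    simpa using Submodule.mul_mem_mul (hf m) ih

section CommRing

variable {𝕜 R : Type*} [CommRing 𝕜] [Ring R] [Algebra 𝕜 R] {n k : ℕ}

lemma exists_tableauOp_eq_mul (b : Fin n → R) {A : Tableau n} (h : 0 < A.rows) :
    ∃ d, d + A.rows = A.size ∧ ∃ u ∈ genSpan 𝕜 b ^ d,
      tableauOp b A = u * columnOp b (A.col 0) := by
  obtain ⟨m, hm⟩ := Nat.exists_eq_add_one.2 (A.cols_pos_iff.2 h)
  refine ⟨∑ l ∈ Finset.range m, A.shape.colLen (l + 1), ?_, _,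
    prod_reverse_map_range_mem (fun l => ?_) m, tableauOp_eq_mul b A hm⟩
  · rw [Tableau.size, hm, Finset.sum_range_succ', Tableau.rows]
  · exact colSpan_le_genSpan_pow 𝕜 b _ (columnOp_mem_colSpan 𝕜 b _)

variable (𝕜) in
/-- The span of the tableau products with `d` boxes. -/
def tableauSpan (b : Fin n → R) (d : ℕ) : Submodule 𝕜 R :=
  Submodule.span 𝕜 (tableauOp b '' {A | A.size = d})

lemma colSpan_eq_bot (b : Fin n → R) (h : n < k) : colSpan 𝕜 b k = ⊥ := by
  rw [colSpan, Submodule.span_eq_bot]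
  rintro _ ⟨I, rfl⟩
  exact columnOp_eq_zero_of_not_injective b fun hI =>
    h.not_ge (by simpa using Fintype.card_le_of_injective I hI)

lemma colSpan_le_colSpanLT (b : Fin n → R) : colSpan 𝕜 b k ≤ colSpanLT 𝕜 b k (k * n + 1) := by
  rw [colSpan, Submodule.span_le]
  rintro _ ⟨K, rfl⟩
  refine columnOp_mem_colSpanLT (Nat.lt_succ_of_le ?_)
  simpa using Finset.sum_le_card_nsmul Finset.univ _ n fun j _ => (K j).isLt.le

end CommRing

variable {𝕜 R : Type*} [Field 𝕜] [CharZero 𝕜] [Ring R] [Algebra 𝕜 R] {n k : ℕ} {b : Fin n → R}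

lemma tableauOp_mul_columnOp_mem_of_lt_rows (hb : TripleComm b) {A : Tableau n} (h : k < A.rows)
    (K : Fin k → Fin n) {e : ℕ} (he : e + A.rows = A.size + k) :
    tableauOp b A * columnOp b K ∈ genSpan 𝕜 b ^ e * colSpan 𝕜 b A.rows := by
  obtain ⟨d, hd, u, hu, hA⟩ := exists_tableauOp_eq_mul (𝕜 := 𝕜) b (Nat.zero_lt_of_lt h)
  obtain rfl : e = d + k := by omega
  rw [hA, mul_assoc, pow_add, mul_assoc]
  refine Submodule.mul_mem_mul hu (colSpan_mul_genSpan_pow_le hb _ _ ?_)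
  exact Submodule.mul_mem_mul (columnOp_mem_colSpan 𝕜 b _)
    (colSpan_le_genSpan_pow 𝕜 b _ (columnOp_mem_colSpan 𝕜 b K))

lemma columnOp_mul_columnOp_mem_of_descent (hb : TripleComm b) {i : ℕ} {I : Fin i → Fin n}
    {K : Fin k → Fin n} (hI : StrictMono I) (hK : StrictMono K) {r : ℕ} (hi : r < i) (hk : r < k)
    (hlt : I ⟨r, hi⟩ < K ⟨r, hk⟩) {e : ℕ} (he : e + 1 = i) :
    columnOp b I * columnOp b K ∈ genSpan 𝕜 b ^ e * colSpan 𝕜 b (k + 1)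
      ⊔ colSpan 𝕜 b i * colSpanLT 𝕜 b k (∑ j, (K j : ℕ)) := by
  obtain ⟨s, rfl⟩ := Nat.exists_eq_add_of_le (Nat.succ_le_of_lt hi)
  obtain ⟨l, rfl⟩ := Nat.exists_eq_add_of_le hk.le
  obtain rfl : e = s + r := by omega
  rw [show r + l + 1 = r + 1 + l by omega]
  exact columnOp_mul_columnOp_mem_of_lt hb hI hK (by omega) hlt

lemma tableauOp_mul_columnOp_mem_of_descent (hb : TripleComm b) {A : Tableau n} {K : Fin k → Fin n}
    (hK : StrictMono K) {r : ℕ} (hr : r < A.rows) (hk : r < k) (hlt : A.col 0 ⟨r, hr⟩ < K ⟨r, hk⟩)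
    {e : ℕ} (he : e + 1 = A.size) :
    tableauOp b A * columnOp b K ∈ genSpan 𝕜 b ^ e * colSpan 𝕜 b (k + 1)
      ⊔ genSpan 𝕜 b ^ A.size * colSpanLT 𝕜 b k (∑ j, (K j : ℕ)) := by
  obtain ⟨d, hd, u, hu, hA⟩ := exists_tableauOp_eq_mul (𝕜 := 𝕜) b (Nat.zero_lt_of_lt hr)
  obtain ⟨i, hi⟩ := Nat.exists_eq_add_one.2 (Nat.zero_lt_of_lt hr)
  obtain rfl : e = d + i := by omega
  have h := Submodule.mul_mem_mul hu (columnOp_mul_columnOp_mem_of_descent (𝕜 := 𝕜) hb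
    (A.col_strictMono 0) hK hr hk hlt hi.symm)
  rw [Submodule.mul_sup, ← mul_assoc, ← mul_assoc, ← pow_add, ← mul_assoc, ← hA] at h
  have hle : genSpan 𝕜 b ^ d * colSpan 𝕜 b A.rows ≤ genSpan 𝕜 b ^ A.size := by
    rw [← hd, pow_add]
    exact mul_le_mul_right (colSpan_le_genSpan_pow 𝕜 b _) _
  exact sup_le_sup_left (mul_le_mul_left hle _) (genSpan 𝕜 b ^ (d + i) * colSpan 𝕜 b (k + 1)) h

lemma genSpan_pow_mul_colSpanLT_le (hb : TripleComm b) (hk : 0 < k) {e : ℕ}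
    (he : genSpan 𝕜 b ^ e ≤ tableauSpan 𝕜 b e)
    (hlong : ∀ k' > k, ∀ e', e' + k' = e + k →
      genSpan 𝕜 b ^ e' * colSpan 𝕜 b k' ≤ tableauSpan 𝕜 b (e + k)) (N : ℕ) :
    genSpan 𝕜 b ^ e * colSpanLT 𝕜 b k N ≤ tableauSpan 𝕜 b (e + k) := by
  induction N with
  | zero => simp [colSpanLT]
  | succ N ih =>
    refine (mul_le_mul_left he _).trans ?_
    rw [tableauSpan, colSpanLT, Submodule.span_mul_span, Submodule.span_le]
    rintro _ ⟨_, ⟨A, rfl, rfl⟩, _, ⟨K, hK, hKN, rfl⟩, rfl⟩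
    rcases lt_or_ge k A.rows with hrows | hrows
    · obtain ⟨d, hd, -⟩ := exists_tableauOp_eq_mul (𝕜 := 𝕜) b (Nat.zero_lt_of_lt hrows)
      have hexp : d + k + A.rows = A.size + k := by omega
      exact hlong _ hrows _ hexp (tableauOp_mul_columnOp_mem_of_lt_rows hb hrows K hexp)
    by_cases hle : ∀ r : Fin A.rows, K ⟨r, r.isLt.trans_le hrows⟩ ≤ A.col 0 r
    · exact Submodule.subset_span ⟨A.cons K hK hrows hle, A.size_cons K hK hrows hle hk,
        tableauOp_cons b A hk K hK hrows hle⟩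
    · push Not at hle
      obtain ⟨r, hr⟩ := hle
      obtain ⟨d, hd, -⟩ := exists_tableauOp_eq_mul (𝕜 := 𝕜) b r.pos
      obtain ⟨e, he'⟩ := Nat.exists_eq_add_one.2 (by have := r.pos; omega : 0 < A.size)
      refine sup_le (hlong (k + 1) k.lt_succ_self e (by omega)) (le_trans ?_ ih)
        (tableauOp_mul_columnOp_mem_of_descent hb hK r.isLt (r.isLt.trans_le hrows) hr he'.symm)
      exact mul_le_mul_right (colSpanLT_mono (Nat.lt_succ_iff.1 hKN)) _

lemma genSpan_pow_mul_colSpan_le (hb : TripleComm b) {d : ℕ}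
    (hd : ∀ e < d, genSpan 𝕜 b ^ e ≤ tableauSpan 𝕜 b e) (k : ℕ) :
    0 < k → ∀ e, e + k = d → genSpan 𝕜 b ^ e * colSpan 𝕜 b k ≤ tableauSpan 𝕜 b d := by
  induction k using Nat.strong_decreasing_induction with
  | base => exact ⟨n, fun k hk _ e _ => by simp [colSpan_eq_bot b hk]⟩
  | step k ih =>
    rintro hk e rfl
    exact (mul_le_mul_right (colSpan_le_colSpanLT b) _).trans
      (genSpan_pow_mul_colSpanLT_le hb hk (hd e (by omega))
        (fun k' hk' => ih k' hk' (hk.trans hk')) _)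

theorem genSpan_pow_le_tableauSpan (hb : TripleComm b) (d : ℕ) :
    genSpan 𝕜 b ^ d ≤ tableauSpan 𝕜 b d := by
  induction d using Nat.strong_induction_on with
  | _ d ih =>
  cases d with
  | zero =>
    rw [pow_zero, Submodule.one_le]
    exact Submodule.subset_span ⟨Tableau.empty n, Tableau.size_empty, tableauOp_empty b⟩
  | succ d =>
    refine le_trans ?_ (genSpan_pow_mul_colSpan_le hb ih 1 one_pos d rfl)
    rw [pow_succ]
    refine mul_le_mul_right ?_ _
    rw [genSpan, Submodule.span_le]
    rintro _ ⟨i, rfl⟩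
    exact columnOp_one b i ▸ columnOp_mem_colSpan 𝕜 b _

lemma adjoin_le_span_tableauOp (hb : TripleComm b) :
    Subalgebra.toSubmodule (Algebra.adjoin 𝕜 (Set.range b))
      ≤ Submodule.span 𝕜 (Set.range (tableauOp b)) := by
  rw [Algebra.adjoin_eq_span, Submodule.span_le]
  intro z hz
  obtain ⟨d, hd⟩ : ∃ d, z ∈ genSpan 𝕜 b ^ d := by
    induction hz using Submonoid.closure_induction with
    | mem x hx => exact ⟨1, by rw [pow_one]; exact Submodule.subset_span hx⟩
    | one => exact ⟨0, by rw [pow_zero]; exact Submodule.one_le.1 le_rfl⟩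
    | mul x y _ _ hx hy =>
      obtain ⟨d, hd⟩ := hx
      obtain ⟨e, he⟩ := hy
      exact ⟨d + e, by rw [pow_add]; exact Submodule.mul_mem_mul hd he⟩
  exact Submodule.span_mono (Set.image_subset_range _ _) (genSpan_pow_le_tableauSpan hb d hd)

end TableauSpan

/-! ### The Clifford realization -/

section GreenAnsatz

variable {𝕜 I κ T : Type*} [CommRing 𝕜] [Ring T] [Algebra 𝕜 T]

/-- The operators `y a α`, for each `α`, satisfy the Weyl relations of the form `s`, the operators
`ε α` satisfy the Clifford relations, and operators of different families commute. -/
structure WeylClifford (s : I → I → 𝕜) (y : I → κ → T) (ε : κ → T) : Prop where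
  commute : ∀ a α β, Commute (ε β) (y a α)
  sq : ∀ α, ε α * ε α = 1
  anticomm : ∀ α β, α ≠ β → ε α * ε β = -(ε β * ε α)
  weyl : ∀ a b α, y a α * y b α = y b α * y a α + s a b • 1
  weyl_ne : ∀ a b α β, α ≠ β → Commute (y a α) (y b β)

/-- Green's ansatz for the paraboson operators. -/
def greenOp [Fintype κ] (y : I → κ → T) (ε : κ → T) (a : I) : T := ∑ α, y a α * ε α

variable {s : I → I → 𝕜} {y : I → κ → T} {ε : κ → T}

namespace WeylClifford

lemma mul_add_mul (h : WeylClifford s y ε) [DecidableEq κ] (a b : I) (α β : κ) :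
    y a α * ε α * (y b β * ε β) + y b β * ε β * (y a α * ε α)
      = if α = β then (2 : 𝕜) • (y b α * y a α) + s a b • 1 else 0 := by
  rw [(h.commute b β α).mul_mul_mul_comm, (h.commute a α β).mul_mul_mul_comm]
  split_ifs with hαβ
  · rw [← hαβ, h.sq, h.weyl, mul_one, mul_one]
    module
  · rw [(h.weyl_ne a b α β hαβ).eq, h.anticomm α β hαβ, mul_neg, neg_add_cancel]

lemma greenOp_anticomm (h : WeylClifford s y ε) [Fintype κ] (a b : I) :
    greenOp y ε a * greenOp y ε b + greenOp y ε b * greenOp y ε a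
      = (2 : 𝕜) • ∑ α, y b α * y a α + (Fintype.card κ * s a b) • 1 := by
  classical
  simp only [greenOp, Finset.sum_mul_sum]
  rw [Finset.sum_comm (f := fun β α => y b β * ε β * (y a α * ε α))]
  simp only [← Finset.sum_add_distrib, h.mul_add_mul, Finset.sum_ite_eq, Finset.mem_univ, if_true]
  rw [Finset.sum_add_distrib, Finset.sum_const, Finset.smul_sum, Finset.card_univ,
    ← Nat.cast_smul_eq_nsmul 𝕜, smul_smul]

lemma mul_mul_eq (h : WeylClifford s y ε) [DecidableEq κ] (a b c : I) (α γ : κ) :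
    y b α * y a α * (y c γ * ε γ) = y c γ * ε γ * (y b α * y a α)
      + if α = γ then s a c • (y b α * ε α) + s b c • (y a α * ε α) else 0 := by
  have hε : ε γ * (y b α * y a α) = y b α * y a α * ε γ :=
    ((h.commute b α γ).mul_right (h.commute a α γ)).eq
  rw [mul_assoc (y c γ), hε, ← mul_assoc, ← mul_assoc]
  split_ifs with hαγ
  · rw [← hαγ, mul_assoc (y b α), h.weyl a c, mul_add, ← mul_assoc, h.weyl b c]
    simp only [add_mul, mul_smul_comm, smul_mul_assoc, mul_one, one_mul, mul_assoc]
    abel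
  · rw [add_zero, ((h.weyl_ne b c α γ hαγ).mul_left (h.weyl_ne a c α γ hαγ)).eq, mul_assoc (y c γ)]

lemma sum_mul_greenOp (h : WeylClifford s y ε) [Fintype κ] (a b c : I) :
    (∑ α, y b α * y a α) * greenOp y ε c = greenOp y ε c * (∑ α, y b α * y a α)
      + (s a c • greenOp y ε b + s b c • greenOp y ε a) := by
  classical
  simp only [greenOp, Finset.sum_mul_sum]
  rw [Finset.sum_comm (f := fun γ α => y c γ * ε γ * (y b α * y a α))]
  simp only [h.mul_mul_eq, Finset.sum_add_distrib, Finset.sum_ite_eq, Finset.mem_univ, if_true,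
    Finset.smul_sum]

theorem greenOp_triple (h : WeylClifford s y ε) [Fintype κ] (a b c : I) :
    (greenOp y ε a * greenOp y ε b + greenOp y ε b * greenOp y ε a) * greenOp y ε c
        - greenOp y ε c * (greenOp y ε a * greenOp y ε b + greenOp y ε b * greenOp y ε a)
      = (2 * s a c) • greenOp y ε b + (2 * s b c) • greenOp y ε a := by
  rw [h.greenOp_anticomm, add_mul, mul_add, smul_mul_assoc, mul_smul_comm, smul_mul_assoc,
    mul_smul_comm, one_mul, mul_one, h.sum_mul_greenOp]
  module

end WeylClifford

end GreenAnsatz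

section Realization

variable {n : ℕ} (q : ℕ)

lemma pderiv_comm {σ R : Type*} [CommRing R] (a b : σ) (f : MvPolynomial σ R) :
    MvPolynomial.pderiv a (MvPolynomial.pderiv b f)
      = MvPolynomial.pderiv b (MvPolynomial.pderiv a f) := by
  classical
  have h : ⁅MvPolynomial.pderiv (R := R) a, MvPolynomial.pderiv (R := R) b⁆ = 0 :=
    MvPolynomial.derivation_ext fun i => by
      simp [Derivation.commutator_apply, MvPolynomial.pderiv_X, Pi.single_apply, apply_ite]
  simpa [Derivation.commutator_apply, sub_eq_zero] using DFunLike.congr_fun h f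

/-- The symplectic form `(η - ξ) δ_{ij} / 2` on the indices `(i, ξ)`, `(j, η)`. -/
noncomputable def sympl (a b : Fin n × ℤˣ) : ℂ :=
  if a.1 = b.1 then (((b.2 : ℤ) : ℂ) - ((a.2 : ℤ) : ℂ)) / 2 else 0

lemma two_mul_sympl (a b : Fin n × ℤˣ) :
    2 * sympl a b = if a.1 = b.1 then (((b.2 : ℤ) - (a.2 : ℤ) : ℤ) : ℂ) else 0 := by
  rw [sympl]
  split_ifs
  · push_cast
    ring
  · ring

/-- The operators `x_{i,α}`, for the index `(i, 1)`, and `∂_{i,α}`, for the index `(i, -1)`. -/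
noncomputable def weylOp (a : Fin n × ℤˣ) (α : Fin q) :
    Module.End ℂ (MvPolynomial (Fin n × Fin q) ℂ) :=
  if a.2 = 1 then LinearMap.mulLeft ℂ (MvPolynomial.X (a.1, α))
  else (MvPolynomial.pderiv (a.1, α)).toLinearMap

lemma weylOp_mul (a b : Fin n × ℤˣ) (α β : Fin q) :
    weylOp q a α * weylOp q b β
      = weylOp q b β * weylOp q a α + (if α = β then sympl a b else 0) • 1 := by
  classical
  refine LinearMap.ext fun f => ?_
  obtain ⟨i, ξ⟩ := a
  obtain ⟨j, η⟩ := b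
  rcases Int.units_eq_one_or ξ with rfl | rfl <;> rcases Int.units_eq_one_or η with rfl | rfl
  · simp [weylOp, sympl, mul_left_comm]
  · have hsympl (i j : Fin n) : sympl (i, 1) (j, -1) = if i = j then -1 else 0 := by
      norm_num [sympl]
    by_cases hij : i = j <;> by_cases hαβ : α = β <;>
      simp [weylOp, hsympl, MvPolynomial.pderiv_X, hij, hαβ]
  · by_cases hij : i = j <;> by_cases hαβ : α = β <;>
      simp [weylOp, sympl, MvPolynomial.pderiv_X, hij, hαβ, Ne.symm]
  · simp [weylOp, sympl, pderiv_comm (i, α)]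

lemma e_mul_self (α : Fin q) : (e α : Cl q) * e α = 1 := by
  rw [e, CliffordAlgebra.ι_sq_scalar]
  simp [QuadraticMap.weightedSumSquares_apply, Pi.single_apply]

variable {q} in
lemma e_mul_e {α β : Fin q} (h : α ≠ β) : (e α : Cl q) * e β = -(e β * e α) := by
  refine CliffordAlgebra.ι_mul_ι_comm_of_isOrtho (QuadraticMap.isOrtho_def.mpr ?_)
  have h₀ : ∀ γ, (Pi.single α 1 : Fin q → ℂ) γ * (Pi.single β 1 : Fin q → ℂ) γ = 0 := fun γ => by
    rcases eq_or_ne γ α with rfl | hγ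
    · simp [h]
    · simp [hγ]
  simp only [QuadraticMap.weightedSumSquares_apply, Pi.add_apply, ← Finset.sum_add_distrib]
  refine Finset.sum_congr rfl fun γ _ => ?_
  simp only [one_smul]
  linear_combination 2 * h₀ γ

/-- The operator by which `B_i^ξ` acts, for the index `(i, ξ)`. -/
noncomputable def realOp (a : Fin n × ℤˣ) : Module.End ℂ (ClPoly n q) :=
  if a.2 = 1 then X n q a.1 else D n q a.1

lemma realOp_pos (i : Fin n) : realOp q (i, 1) = X n q i := if_pos rfl

lemma realOp_neg (i : Fin n) : realOp q (i, -1) = D n q i :=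
  if_neg (show (-1 : ℤˣ) ≠ 1 by decide)

lemma weylClifford : WeylClifford (sympl (n := n))
    (fun a α => (weylOp q a α).rTensor (Cl q))
    (fun α => (LinearMap.mulLeft ℂ (e α : Cl q)).lTensor (MvPolynomial (Fin n × Fin q) ℂ)) where
  commute a α β := by
    rw [commute_iff_eq, Module.End.mul_eq_comp, Module.End.mul_eq_comp,
      LinearMap.lTensor_comp_rTensor, LinearMap.rTensor_comp_lTensor]
  sq α := by
    rw [← LinearMap.lTensor_mul, Module.End.mul_eq_comp, ← LinearMap.mulLeft_mul, e_mul_self,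
      LinearMap.mulLeft_one, LinearMap.lTensor_id]
    rfl
  anticomm α β h := by
    rw [← LinearMap.lTensor_mul, ← LinearMap.lTensor_mul, ← LinearMap.lTensor_neg,
      Module.End.mul_eq_comp, Module.End.mul_eq_comp, ← LinearMap.mulLeft_mul,
      ← LinearMap.mulLeft_mul, e_mul_e h]
    congr 1
    ext
    simp [mul_assoc]
  weyl a b α := by
    rw [← LinearMap.rTensor_mul, weylOp_mul, if_pos rfl, LinearMap.rTensor_add,
      LinearMap.rTensor_mul, LinearMap.rTensor_smul]
    congr 2
    exact LinearMap.rTensor_id _ _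
  weyl_ne a b α β h := by
    rw [commute_iff_eq, ← LinearMap.rTensor_mul, weylOp_mul, if_neg h, zero_smul, add_zero,
      LinearMap.rTensor_mul]

lemma realOp_eq_greenOp (a : Fin n × ℤˣ) : realOp q a
    = greenOp (fun a α => (weylOp q a α).rTensor (Cl q))
      (fun α => (LinearMap.mulLeft ℂ (e α)).lTensor (MvPolynomial (Fin n × Fin q) ℂ)) a := by
  simp only [greenOp, Module.End.mul_eq_comp, LinearMap.rTensor_comp_lTensor, realOp, weylOp, X, D]
  split_ifs <;> rfl

lemma realOp_triple (a b c : Fin n × ℤˣ) :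
    (realOp q a * realOp q b + realOp q b * realOp q a) * realOp q c
        - realOp q c * (realOp q a * realOp q b + realOp q b * realOp q a)
      = (if a.1 = c.1 then (((c.2 : ℤ) - (a.2 : ℤ) : ℤ) : ℂ) else 0) • realOp q b
        + (if b.1 = c.1 then (((c.2 : ℤ) - (b.2 : ℤ) : ℤ) : ℂ) else 0) • realOp q a := by
  simp only [realOp_eq_greenOp, (weylClifford q).greenOp_triple, two_mul_sympl]

lemma D_one (i : Fin n) : D n q i 1 = 0 := by
  simp [D, Algebra.TensorProduct.one_def]

lemma D_mul_X_add_X_mul_D_one (i j : Fin n) :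
    (D n q j * X n q i + X n q i * D n q j) 1 = (if i = j then (q : ℂ) else 0) • 1 := by
  have hquad : ∀ α, ((weylOp q (i, 1) α).rTensor (Cl q)
      * (weylOp q (j, -1) α).rTensor (Cl q)) 1 = 0 := fun α => by
    rw [Module.End.mul_apply, Algebra.TensorProduct.one_def, LinearMap.rTensor_tmul]
    simp [weylOp]
  rw [← realOp_pos, ← realOp_neg, realOp_eq_greenOp, realOp_eq_greenOp,
    (weylClifford q).greenOp_anticomm, LinearMap.add_apply, LinearMap.smul_apply,
    LinearMap.sum_apply, Finset.sum_eq_zero fun α _ => hquad α, smul_zero, zero_add,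
    LinearMap.smul_apply, Module.End.one_apply, Fintype.card_fin]
  congr 1
  simp [sympl, eq_comm]

variable (n) in
/-- The representation of `osp(1|2n)` on Clifford algebra valued polynomials. -/
noncomputable def realization : UOsp n →ₐ[ℂ] Module.End ℂ (ClPoly n q) :=
  RingQuot.liftAlgHom ℂ (s := Rel n)
    ⟨FreeAlgebra.lift ℂ (realOp q), by
      rintro _ _ ⟨i, j, l, ξ, η, ζ⟩
      simpa only [map_sub, map_mul, map_add, map_smul, FreeAlgebra.lift_ι_apply] using
        realOp_triple q (i, ξ) (j, η) (l, ζ)⟩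

lemma realization_gen (ξ : ℤˣ) (i : Fin n) : realization n q (gen n ξ i) = realOp q (i, ξ) :=
  (RingQuot.liftAlgHom_mkAlgHom_apply ℂ _ _ _).trans (FreeAlgebra.lift_ι_apply _ _)

lemma realization_gen_pos (i : Fin n) : realization n q (gen n 1 i) = X n q i := by
  rw [realization_gen, realOp_pos]

lemma realization_gen_neg (i : Fin n) : realization n q (gen n (-1) i) = D n q i := by
  rw [realization_gen, realOp_neg]

variable {q} in
lemma realization_one_of_mem {u : UOsp n} (hu : u ∈ vacuumIdeal n q) :
    realization n q u 1 = 0 := by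
  rw [vacuumIdeal] at hu
  induction hu using Submodule.span_induction with
  | zero => simp
  | add x y _ _ hx hy => simp [hx, hy]
  | smul a x _ hx => rw [smul_eq_mul, map_mul, Module.End.mul_apply, hx, map_zero]
  | mem x hx =>
    rcases hx with (⟨i, rfl⟩ | ⟨⟨i, j⟩, rfl⟩) | ⟨⟨i, j⟩, rfl⟩
    · simp only [realization_gen_neg, D_one]
    · simp only [map_add, map_mul, realization_gen_neg, LinearMap.add_apply, Module.End.mul_apply,
        D_one, map_zero, add_zero]
    · simp only [map_sub, map_add, map_mul, realization_gen_neg, realization_gen_pos,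
        AlgHom.commutes]
      rw [LinearMap.sub_apply, add_comm, D_mul_X_add_X_mul_D_one, Module.algebraMap_end_apply,
        sub_self]

end Realization

/-! ### Leading terms -/

section LeadingTerm

open MonomialOrder MvPolynomial

variable {σ 𝕜 A : Type*} [CommRing 𝕜] [Ring A] [Algebra 𝕜 A]

variable (𝕜 A) in
/-- The polynomials with coefficients in `A` whose exponents lie in `S`. -/
noncomputable def termSpan (S : Set (σ →₀ ℕ)) : Submodule 𝕜 (MvPolynomial σ 𝕜 ⊗[𝕜] A) :=
  Submodule.span 𝕜 {z | ∃ m ∈ S, ∃ c : A, z = monomial m (1 : 𝕜) ⊗ₜ[𝕜] c}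

lemma monomial_tmul_mem_termSpan {S : Set (σ →₀ ℕ)} {m : σ →₀ ℕ} (hm : m ∈ S) (c : A) :
    monomial m (1 : 𝕜) ⊗ₜ[𝕜] c ∈ termSpan 𝕜 A S :=
  Submodule.subset_span ⟨m, hm, c, rfl⟩

lemma termSpan_mono {S S' : Set (σ →₀ ℕ)} (h : S ⊆ S') : termSpan 𝕜 A S ≤ termSpan 𝕜 A S' :=
  Submodule.span_mono fun _ ⟨m, hm, c, hz⟩ => ⟨m, h hm, c, hz⟩

lemma monomial_tmul_mul (m m' : σ →₀ ℕ) (u u' : A) :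
    monomial m (1 : 𝕜) ⊗ₜ[𝕜] u * monomial m' (1 : 𝕜) ⊗ₜ[𝕜] u'
      = monomial (m + m') (1 : 𝕜) ⊗ₜ[𝕜] (u * u') := by
  rw [Algebra.TensorProduct.tmul_mul_tmul, monomial_mul, one_mul]

lemma mul_mem_termSpan {S S' S'' : Set (σ →₀ ℕ)} (h : ∀ m ∈ S, ∀ m' ∈ S', m + m' ∈ S'')
    {f g : MvPolynomial σ 𝕜 ⊗[𝕜] A} (hf : f ∈ termSpan 𝕜 A S) (hg : g ∈ termSpan 𝕜 A S') :
    f * g ∈ termSpan 𝕜 A S'' := by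
  have hle : termSpan 𝕜 A S * termSpan 𝕜 A S' ≤ termSpan 𝕜 A S'' := by
    rw [termSpan, termSpan, Submodule.span_mul_span, Submodule.span_le]
    rintro _ ⟨_, ⟨m, hm, c, rfl⟩, _, ⟨m', hm', c', rfl⟩, rfl⟩
    beta_reduce
    rw [monomial_tmul_mul]
    exact monomial_tmul_mem_termSpan (h m hm m' hm') _
  exact hle (Submodule.mul_mem_mul hf hg)

/-- The leading term of `f` for the monomial order `mo` is `x^m ⊗ u`. The coefficient `u` is not
required to be nonzero. -/
def HasLeadingTerm (mo : MonomialOrder σ) (f : MvPolynomial σ 𝕜 ⊗[𝕜] A) (m : σ →₀ ℕ) (u : A) :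
    Prop :=
  f - monomial m (1 : 𝕜) ⊗ₜ[𝕜] u ∈ termSpan 𝕜 A {m' | m' ≺[mo] m}

variable (𝕜 A) in
/-- The coefficient of `x^m`. -/
noncomputable def monomialCoeff (m : σ →₀ ℕ) : MvPolynomial σ 𝕜 ⊗[𝕜] A →ₗ[𝕜] A :=
  (TensorProduct.lid 𝕜 A).toLinearMap ∘ₗ (lcoeff 𝕜 m).rTensor A

lemma monomialCoeff_monomial_tmul [DecidableEq σ] (m m' : σ →₀ ℕ) (c : A) :
    monomialCoeff 𝕜 A m (monomial m' (1 : 𝕜) ⊗ₜ[𝕜] c) = if m' = m then c else 0 := by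
  simp [monomialCoeff, lcoeff_apply, coeff_monomial]

lemma monomialCoeff_eq_zero {S : Set (σ →₀ ℕ)} {m : σ →₀ ℕ} (hm : m ∉ S)
    {f : MvPolynomial σ 𝕜 ⊗[𝕜] A} (hf : f ∈ termSpan 𝕜 A S) : monomialCoeff 𝕜 A m f = 0 := by
  classical
  have hle : termSpan 𝕜 A S ≤ LinearMap.ker (monomialCoeff 𝕜 A m) := by
    rw [termSpan, Submodule.span_le]
    rintro _ ⟨m', hm', c, rfl⟩
    rw [SetLike.mem_coe, LinearMap.mem_ker, monomialCoeff_monomial_tmul,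
      if_neg (ne_of_mem_of_not_mem hm' hm)]
  exact hle hf

namespace HasLeadingTerm

variable {mo : MonomialOrder σ} {f g : MvPolynomial σ 𝕜 ⊗[𝕜] A} {m m' : σ →₀ ℕ} {u u' : A}

lemma mem_termSpan (hf : HasLeadingTerm mo f m u) : f ∈ termSpan 𝕜 A {m' | m' ≼[mo] m} := by
  rw [← sub_add_cancel f (monomial m (1 : 𝕜) ⊗ₜ[𝕜] u)]
  exact Submodule.add_mem _ (termSpan_mono (fun _ h => le_of_lt h) hf)
    (monomial_tmul_mem_termSpan (le_refl (mo.toSyn m)) u)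

lemma one : HasLeadingTerm mo (1 : MvPolynomial σ 𝕜 ⊗[𝕜] A) 0 1 := by
  rw [HasLeadingTerm, Algebra.TensorProduct.one_def, ← C_apply, C_1, sub_self]
  exact Submodule.zero_mem _

lemma mul (hf : HasLeadingTerm mo f m u) (hg : HasLeadingTerm mo g m' u') :
    HasLeadingTerm mo (f * g) (m + m') (u * u') := by
  have hsplit : f * g - monomial (m + m') (1 : 𝕜) ⊗ₜ[𝕜] (u * u')
      = (f - monomial m (1 : 𝕜) ⊗ₜ[𝕜] u) * g
        + monomial m (1 : 𝕜) ⊗ₜ[𝕜] u * (g - monomial m' (1 : 𝕜) ⊗ₜ[𝕜] u') := by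
    rw [← monomial_tmul_mul, sub_mul, mul_sub, sub_add_sub_cancel]
  rw [HasLeadingTerm, hsplit]
  refine Submodule.add_mem _ (mul_mem_termSpan (fun k hk k' hk' => ?_) hf hg.mem_termSpan)
    (mul_mem_termSpan (S := {m}) (fun k hk k' hk' => ?_)
      (monomial_tmul_mem_termSpan (Set.mem_singleton m) u) hg)
  · simpa only [Set.mem_ofPred_eq, map_add] using add_lt_add_of_lt_of_le hk hk'
  · rw [Set.mem_singleton_iff.mp hk]
    simpa only [Set.mem_ofPred_eq, map_add] using add_lt_add_right hk' _

lemma smul (hf : HasLeadingTerm mo f m u) (c : 𝕜) : HasLeadingTerm mo (c • f) m (c • u) := by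
  have hmem := Submodule.smul_mem _ c hf
  rwa [smul_sub, ← TensorProduct.tmul_smul] at hmem

lemma monomialCoeff_eq [DecidableEq σ] (hf : HasLeadingTerm mo f m' u) (h : m' ≼[mo] m) :
    monomialCoeff 𝕜 A m f = if m' = m then u else 0 := by
  have hzero := monomialCoeff_eq_zero (S := {k | k ≺[mo] m'}) (m := m)
    (by rwa [Set.mem_ofPred_eq, not_lt]) hf
  rwa [map_sub, monomialCoeff_monomial_tmul, sub_eq_zero] at hzero

lemma linearIndependent [IsDomain 𝕜] [Module.IsTorsionFree 𝕜 A] {ι : Type*}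
    {f : ι → MvPolynomial σ 𝕜 ⊗[𝕜] A} {m : ι → σ →₀ ℕ} {u : ι → A} (hm : Function.Injective m)
    (hu : ∀ i, u i ≠ 0) (h : ∀ i, HasLeadingTerm mo (f i) (m i) (u i)) :
    LinearIndependent 𝕜 f := by
  classical
  rw [linearIndependent_iff]
  intro l hl
  by_contra hne
  obtain ⟨i, hi, hmax⟩ := Finset.exists_max_image l.support (fun i => mo.toSyn (m i))
    (Finsupp.support_nonempty_iff.2 hne)
  have hcoeff := congrArg (monomialCoeff 𝕜 A (m i)) hl
  rw [Finsupp.linearCombination_apply, Finsupp.sum, map_sum, map_zero,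
    Finset.sum_eq_single_of_mem i hi, map_smul, (h i).monomialCoeff_eq le_rfl, if_pos rfl]
    at hcoeff
  · exact (smul_ne_zero (Finsupp.mem_support_iff.1 hi) (hu i)) hcoeff
  · intro j hj hji
    rw [map_smul, (h j).monomialCoeff_eq (hmax j hj), if_neg fun h => hji (hm h), smul_zero]

end HasLeadingTerm

end LeadingTerm

section Anticommute

variable {R : Type*} [Ring R] {n k : ℕ} {b : Fin n → R} {c : R}

lemma wordOp_mul_of_anticomm {s : Fin k → Fin n} (h : ∀ r, b (s r) * c = -(c * b (s r))) :
    wordOp b s * c = (-1 : ℤ) ^ k • (c * wordOp b s) := by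
  induction k with
  | zero => simp [wordOp_zero]
  | succ k ih =>
    rw [wordOp_succ, mul_assoc, ih fun r => h r.succ, mul_smul_comm, ← mul_assoc, h 0, pow_succ,
      neg_mul, mul_smul, mul_assoc, neg_one_smul]

lemma columnOp_mul_of_anticomm {s : Fin k → Fin n} (h : ∀ r, b (s r) * c = -(c * b (s r))) :
    columnOp b s * c = (-1 : ℤ) ^ k • (c * columnOp b s) := by
  rw [columnOp_eq_sum_wordOp, Finset.sum_mul, Finset.mul_sum, Finset.smul_sum]
  refine Finset.sum_congr rfl fun σ _ => ?_
  rw [smul_mul_assoc, mul_smul_comm, wordOp_mul_of_anticomm (s := s ∘ σ) fun r => h (σ r)]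
  exact smul_comm _ _ _

end Anticommute

/-! ### Columns in the Clifford realization -/

section CliffordColumn

variable {n q k : ℕ}

lemma e_tripleComm (q : ℕ) : TripleComm (e : Fin q → Cl q) := by
  intro i j l
  rcases eq_or_ne i j with rfl | h
  · rw [e_mul_self, ← two_smul ℕ]
    exact (Commute.one_left _).smul_left 2
  · rw [e_mul_e h, neg_add_cancel]
    exact Commute.zero_left _

lemma columnOp_e_snoc {s : Fin k → Fin q} {a : Fin q} (h : ∀ r, s r ≠ a) :
    columnOp e (Fin.snoc s a : Fin (k + 1) → Fin q) = (k + 1) • (columnOp e s * e a : Cl q) := by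
  have hanti := columnOp_mul_of_anticomm fun r => e_mul_e (h r)
  have htwo := two_smul_columnOp_snoc ℂ (e_tripleComm q) s a
  rw [← hanti, ← two_smul ℕ, smul_comm] at htwo
  rw [← Nat.cast_smul_eq_nsmul ℂ, ← Nat.cast_smul_eq_nsmul ℂ 2] at htwo
  exact smul_right_injective _ (by norm_num) htwo

lemma isUnit_columnOp_e {s : Fin k → Fin q} (hs : Function.Injective s) :
    IsUnit (columnOp e s : Cl q) := by
  induction k with
  | zero => rw [columnOp_zero]; exact isUnit_one
  | succ k ih =>
    have hunit : IsUnit ((k + 1 : ℕ) : ℂ) :=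
      isUnit_iff_ne_zero.2 (Nat.cast_ne_zero.2 k.succ_ne_zero)
    have hlast (r : Fin k) : Fin.init s r ≠ s (Fin.last k) := fun h => r.castSucc_ne_last (hs h)
    rw [← Fin.snoc_init_self s, columnOp_e_snoc hlast, ← Nat.cast_smul_eq_nsmul ℂ, Algebra.smul_def]
    exact (hunit.map _).mul ((ih (hs.comp (Fin.castSucc_injective k))).mul
      ⟨⟨e _, e _, e_mul_self q _, e_mul_self q _⟩, rfl⟩)

variable (q) in
/-- The element `∑_α x_{i,α} e_α`, by which `X_i` multiplies. -/
noncomputable def clVar (i : Fin n) : ClPoly n q :=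
  ∑ α : Fin q, (MvPolynomial.X (i, α) : MvPolynomial (Fin n × Fin q) ℂ) ⊗ₜ[ℂ] e α

lemma X_eq_lmul_clVar (i : Fin n) : X n q i = Algebra.lmul ℂ (ClPoly n q) (clVar q i) := by
  rw [X, clVar, map_sum]
  refine Finset.sum_congr rfl fun α _ => TensorProduct.ext' fun f c => ?_
  simp

/-- The exponent of the product of the `x_{I(r), s(r)}`. -/
noncomputable def wordExp (I : Fin k → Fin n) (s : Fin k → Fin q) : Fin n × Fin q →₀ ℕ :=
  ∑ r, Finsupp.single (I r, s r) 1

lemma wordExp_comp_perm (I : Fin k → Fin n) (s : Fin k → Fin q) (σ : Equiv.Perm (Fin k)) :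
    wordExp (I ∘ σ) (s ∘ σ) = wordExp I s :=
  Equiv.sum_comp σ fun r => Finsupp.single (I r, s r) 1

lemma wordExp_apply (I : Fin k → Fin n) (s : Fin k → Fin q) (a : Fin n × Fin q) :
    wordExp I s a = ∑ r, if (I r, s r) = a then 1 else 0 := by
  simp [wordExp, Finsupp.finsetSum_apply, Finsupp.single_apply]

lemma wordOp_clVar (I : Fin k → Fin n) : wordOp (clVar q) I
    = ∑ s : Fin k → Fin q, MvPolynomial.monomial (wordExp I s) 1 ⊗ₜ[ℂ] wordOp e s := by
  have hdist := (MultilinearMap.mkPiAlgebraFin ℂ k (ClPoly n q)).map_sum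
    fun (r : Fin k) (α : Fin q) =>
      (MvPolynomial.X (I r, α) : MvPolynomial (Fin n × Fin q) ℂ) ⊗ₜ[ℂ] (e α : Cl q)
  simp only [MultilinearMap.mkPiAlgebraFin_apply] at hdist
  refine hdist.trans (Finset.sum_congr rfl fun s _ => ?_)
  rw [list_prod_tmul, List.prod_ofFn, wordExp, MvPolynomial.monomial_sum_one]
  rfl

lemma columnOp_clVar (I : Fin k → Fin n) : columnOp (clVar q) I
    = ∑ s : Fin k → Fin q, MvPolynomial.monomial (wordExp I s) 1 ⊗ₜ[ℂ] columnOp e s := by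
  simp only [columnOp_eq_sum_wordOp, wordOp_clVar, TensorProduct.tmul_sum, Finset.smul_sum]
  rw [Finset.sum_comm (s := Finset.univ (α := Fin k → Fin q))]
  refine Finset.sum_congr rfl fun σ _ =>
    (Fintype.sum_equiv (Equiv.arrowCongr σ.symm (Equiv.refl _)) _ _ fun s => ?_).symm
  rw [show (Equiv.arrowCongr σ.symm (Equiv.refl (Fin q))) s = s ∘ σ from rfl, wordExp_comp_perm,
    TensorProduct.tmul_smul]
  rfl

lemma columnOp_clVar_eq_zero (I : Fin k → Fin n) (h : q < k) : columnOp (clVar q) I = 0 := by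
  rw [columnOp_clVar]
  refine Finset.sum_eq_zero fun s _ => ?_
  rw [columnOp_eq_zero_of_not_injective, TensorProduct.tmul_zero]
  exact fun hs => h.not_ge (by simpa using Fintype.card_le_of_injective s hs)

variable (n q) in
/-- The lexicographic monomial order on the variables `x_{i,α}`, of which the largest is the one
with the lexicographically smallest index `(i, α)`. -/
noncomputable def lexOrder : MonomialOrder (Fin n × Fin q) :=
  { MonomialOrder.lex (σ := Fin n ×ₗ Fin q) with
    toSyn := (Finsupp.domCongr toLex).trans MonomialOrder.lex.toSyn
    toSyn_monotone := fun _ _ h => MonomialOrder.lex.toSyn_monotone fun a => h (ofLex a) }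

open MonomialOrder in
lemma lexOrder_lt {m m' : Fin n × Fin q →₀ ℕ} {a : Fin n × Fin q}
    (hlt : ∀ b, toLex b < toLex a → m b = m' b) (ha : m a < m' a) : m ≺[lexOrder n q] m' :=
  ⟨toLex a, fun b hb => hlt (ofLex b) hb, ha⟩

lemma exists_forall_lt_eq_castLE (hk : k ≤ q) {s : Fin k → Fin q} (hs : Function.Injective s)
    (hne : s ≠ Fin.castLE hk) :
    ∃ r, (∀ t < r, s t = Fin.castLE hk t) ∧ Fin.castLE hk r < s r := by
  obtain ⟨r, hr, hmin⟩ := WellFounded.has_min (wellFounded_lt (α := Fin k))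
    {r | s r ≠ Fin.castLE hk r} (Function.ne_iff.mp hne)
  have hbelow : ∀ t < r, s t = Fin.castLE hk t := fun t ht => not_not.mp fun h => hmin t h ht
  refine ⟨r, hbelow, lt_of_le_of_ne (not_lt.mp fun hlt => ?_) (Ne.symm hr)⟩
  have hlt' : (s r : ℕ) < r := hlt
  have ht := hbelow ⟨s r, hlt'.trans r.isLt⟩ hlt'
  exact hlt'.ne (congrArg Fin.val (hs (ht.trans (Fin.ext rfl))))

open MonomialOrder in
lemma wordExp_lt (hk : k ≤ q) {I : Fin k → Fin n} (hI : StrictMono I) {s : Fin k → Fin q}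
    (hs : Function.Injective s) (hne : s ≠ Fin.castLE hk) :
    wordExp I s ≺[lexOrder n q] wordExp I (Fin.castLE hk) := by
  obtain ⟨r, hbelow, hr⟩ := exists_forall_lt_eq_castLE hk hs hne
  have hle : ∀ t α, r ≤ t → (t = r → Fin.castLE hk r ≤ α) →
      toLex (I r, Fin.castLE hk r) ≤ toLex (I t, α) := fun t α ht hα =>
    Prod.Lex.toLex_le_toLex.mpr <| ht.lt_or_eq.imp (fun h => hI h)
      fun h => ⟨congrArg I h, hα h.symm⟩
  refine lexOrder_lt (a := (I r, Fin.castLE hk r)) (fun b hb => ?_) ?_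
  · rw [wordExp_apply, wordExp_apply]
    refine Finset.sum_congr rfl fun t _ => ?_
    rcases lt_or_ge t r with ht | ht
    · rw [hbelow t ht]
    · rw [if_neg, if_neg]
      · rintro rfl
        exact hb.not_ge (hle t _ ht fun h => h ▸ le_rfl)
      · rintro rfl
        exact hb.not_ge (hle t _ ht fun h => h ▸ hr.le)
  · have hzero : wordExp I s (I r, Fin.castLE hk r) = 0 := by
      rw [wordExp_apply]
      refine Finset.sum_eq_zero fun t _ => if_neg fun h => ?_
      obtain rfl : t = r := hI.injective (Prod.mk.inj h).1
      exact hr.ne' (Prod.mk.inj h).2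
    rw [hzero, wordExp_apply]
    exact Finset.sum_pos' (fun _ _ => Nat.zero_le _) ⟨r, Finset.mem_univ _, by simp⟩

lemma hasLeadingTerm_columnOp_clVar (hk : k ≤ q) {I : Fin k → Fin n} (hI : StrictMono I) :
    HasLeadingTerm (lexOrder n q) (columnOp (clVar q) I) (wordExp I (Fin.castLE hk))
      (columnOp e (Fin.castLE hk)) := by
  rw [HasLeadingTerm, columnOp_clVar,
    ← Finset.add_sum_erase _ _ (Finset.mem_univ (Fin.castLE hk)),
    add_sub_cancel_left]
  refine Submodule.sum_mem _ fun s hs => ?_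
  by_cases hinj : Function.Injective s
  · refine monomial_tmul_mem_termSpan ?_ _
    exact wordExp_lt hk hI hinj (Finset.ne_of_mem_erase hs)
  · rw [columnOp_eq_zero_of_not_injective _ hinj, TensorProduct.tmul_zero]
    exact Submodule.zero_mem _

end CliffordColumn

section TableauLeadingTerm

variable {n q : ℕ}

lemma map_tableauOp {R S F : Type*} [Ring R] [Ring S] [FunLike F R S] [RingHomClass F R S] (φ : F)
    (b : Fin n → R) (A : Tableau n) : φ (tableauOp b A) = tableauOp (fun i => φ (b i)) A := by
  simp only [tableauOp, map_list_prod, List.map_reverse, List.map_map, Function.comp_def,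
    map_columnOp]

namespace Tableau

/-- The entries of a row, from left to right. -/
def row (A : Tableau n) (r : ℕ) : List ℕ := (List.range (A.shape.rowLen r)).map (A.filling r)

lemma sortedLE_row (A : Tableau n) (r : ℕ) : (A.row r).SortedLE := by
  rw [row, List.sortedLE_iff_pairwise, List.pairwise_map]
  refine List.pairwise_lt_range.imp_of_mem fun {l m} _ hm hlm => ?_
  exact A.filling.row_weak hlm (YoungDiagram.mem_iff_lt_rowLen.2 (List.mem_range.1 hm))

lemma lt_of_mem_row {A : Tableau n} {r i : ℕ} (h : i ∈ A.row r) : i < n := by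
  obtain ⟨l, hl, rfl⟩ := List.mem_map.1 h
  exact A.entry_lt (YoungDiagram.mem_iff_lt_rowLen.2 (List.mem_range.1 hl))

lemma row_eq_nil {A : Tableau n} {r : ℕ} (h : A.rows ≤ r) : A.row r = [] := by
  rw [row, List.map_eq_nil_iff, List.range_eq_nil]
  by_contra hlen
  have hmem := YoungDiagram.mem_iff_lt_rowLen.2 (Nat.pos_of_ne_zero hlen)
  exact h.not_gt (YoungDiagram.mem_iff_lt_colLen.1 hmem)

lemma ext_row {A B : Tableau n} (h : ∀ r, A.row r = B.row r) : A = B := by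
  obtain ⟨μ, f, hf⟩ := A
  obtain ⟨ν, g, hg⟩ := B
  have hlen (r : ℕ) : μ.rowLen r = ν.rowLen r := by simpa [row] using congrArg List.length (h r)
  obtain rfl : μ = ν := SetLike.ext fun c => by
    rw [← Prod.mk.eta (p := c), YoungDiagram.mem_iff_lt_rowLen, hlen,
      YoungDiagram.mem_iff_lt_rowLen]
  obtain rfl : f = g := by
    ext r l
    by_cases hm : (r, l) ∈ μ
    · exact List.map_inj_left.1 (h r) l (List.mem_range.2 (YoungDiagram.mem_iff_lt_rowLen.1 hm))
    · rw [f.zeros hm, g.zeros hm]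
  rfl

end Tableau

/-- The exponent of the monomial in which `x_{i,α}` appears as often as row `α` has an entry
`i`. -/
noncomputable def tableauExp (A : Tableau n) (h : A.rows ≤ q) : Fin n × Fin q →₀ ℕ :=
  ∑ l ∈ Finset.range A.cols, wordExp (A.col l) (Fin.castLE ((A.colLen_le_rows l).trans h))

lemma exists_hasLeadingTerm_tableauOp_clVar (A : Tableau n) (h : A.rows ≤ q) :
    ∃ u, IsUnit u ∧ HasLeadingTerm (lexOrder n q) (tableauOp (clVar q) A) (tableauExp A h) u := by
  rw [tableauOp, tableauExp]
  induction A.cols with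
  | zero => exact ⟨1, isUnit_one, HasLeadingTerm.one⟩
  | succ m ih =>
    obtain ⟨u, hu, hlead⟩ := ih
    have hcol := (A.colLen_le_rows m).trans h
    refine ⟨_, (isUnit_columnOp_e (Fin.castLE_injective hcol)).mul hu, ?_⟩
    rw [List.range_succ, List.map_append, List.reverse_append, List.prod_append,
      Finset.sum_range_succ, add_comm]
    simpa using (hasLeadingTerm_columnOp_clVar hcol (A.col_strictMono m)).mul hlead

lemma wordExp_col_apply (A : Tableau n) (h : A.rows ≤ q) (i : Fin n) (α : Fin q) (l : ℕ) :
    wordExp (A.col l) (Fin.castLE ((A.colLen_le_rows l).trans h)) (i, α)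
      = if l < A.shape.rowLen α ∧ A.filling α l = i then 1 else 0 := by
  simp only [wordExp_apply, ← YoungDiagram.mem_iff_lt_rowLen, YoungDiagram.mem_iff_lt_colLen]
  by_cases hα : (α : ℕ) < A.shape.colLen l
  · rw [Finset.sum_eq_single_of_mem ⟨α, hα⟩ (Finset.mem_univ _)]
    · simp [hα, Fin.ext_iff, Tableau.col]
    · intro r _ hr
      rw [if_neg fun heq => hr (Fin.ext (congrArg (fun a => (a.2 : ℕ)) heq))]
  · rw [if_neg (hα ·.1)]
    refine Finset.sum_eq_zero fun r _ => if_neg fun heq => hα ?_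
    rw [← congrArg (fun a => (a.2 : ℕ)) heq]
    exact r.isLt

lemma tableauExp_apply (A : Tableau n) (h : A.rows ≤ q) (i : Fin n) (α : Fin q) :
    tableauExp A h (i, α) = (A.row α).count (i : ℕ) := by
  have hrange : {l ∈ Finset.range A.cols | l < A.shape.rowLen α ∧ A.filling α l = i}
      = {l ∈ Finset.range (A.shape.rowLen α) | (i : ℕ) = A.filling α l} := by
    have hle : A.shape.rowLen α ≤ A.cols := A.shape.rowLen_anti 0 α (Nat.zero_le _)
    ext l
    simp only [Finset.mem_filter, Finset.mem_range]
    grind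
  rw [tableauExp, Finsupp.finsetSum_apply,
    Finset.sum_congr rfl fun l _ => wordExp_col_apply A h i α l, Finset.sum_boole, Nat.cast_id,
    hrange, Tableau.row, ← Multiset.coe_count, ← Multiset.map_coe, Multiset.count_map]
  rfl

lemma tableauExp_injective {A B : Tableau n} (hA : A.rows ≤ q) (hB : B.rows ≤ q)
    (h : tableauExp A hA = tableauExp B hB) : A = B := by
  refine Tableau.ext_row fun r => ?_
  rcases lt_or_ge r q with hr | hr
  · refine (List.perm_iff_count.2 fun i => ?_).eq_of_sortedLE (A.sortedLE_row r) (B.sortedLE_row r)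
    by_cases hi : i < n
    · simpa only [tableauExp_apply] using DFunLike.congr_fun h (⟨i, hi⟩, ⟨r, hr⟩)
    · rw [List.count_eq_zero_of_not_mem fun hm => hi (Tableau.lt_of_mem_row hm),
        List.count_eq_zero_of_not_mem fun hm => hi (Tableau.lt_of_mem_row hm)]
  · rw [Tableau.row_eq_nil (hA.trans hr), Tableau.row_eq_nil (hB.trans hr)]

lemma ω_eq_tableauOp_clVar (q : ℕ) (A : Tableau n) : ω n q A = tableauOp (clVar q) A := by
  have hmap := map_tableauOp (Algebra.lmul ℂ (ClPoly n q)) (clVar q) A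
  rw [ω, funext X_eq_lmul_clVar, ← hmap]
  exact mul_one _

lemma shapeFactorial_ne_zero (A : Tableau n) : (A.shapeFactorial : ℂ) ≠ 0 :=
  Nat.cast_ne_zero.2 (Finset.prod_ne_zero_iff.2 fun _ _ => Nat.factorial_ne_zero _)

theorem linearIndependent_ωTilde (n q : ℕ) :
    LinearIndependent ℂ (fun A : {A : Tableau n // A.rows ≤ q} => ωTilde n q A.1) := by
  choose u hu hlead using fun A : {A : Tableau n // A.rows ≤ q} =>
    exists_hasLeadingTerm_tableauOp_clVar A.1 A.2
  refine HasLeadingTerm.linearIndependent (mo := lexOrder n q) (m := fun A => tableauExp A.1 A.2)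
    (u := fun A => (A.1.shapeFactorial : ℂ)⁻¹ • u A) ?_ ?_ ?_
  · exact fun A B hAB => Subtype.ext (tableauExp_injective A.2 B.2 hAB)
  · exact fun A => smul_ne_zero (inv_ne_zero (shapeFactorial_ne_zero A.1)) (hu A).ne_zero
  · intro A
    rw [ωTilde, ω_eq_tableauOp_clVar]
    exact (hlead A).smul _

lemma ωTilde_eq_zero {A : Tableau n} (h : q < A.rows) : ωTilde n q A = 0 := by
  obtain ⟨m, hm⟩ := Nat.exists_eq_add_one.2 (A.cols_pos_iff.2 (Nat.zero_lt_of_lt h))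
  rw [ωTilde, ω_eq_tableauOp_clVar, tableauOp_eq_mul _ A hm, columnOp_clVar_eq_zero (A.col 0) h,
    mul_zero, smul_zero]

end TableauLeadingTerm

/-! ### Lowering operators -/

lemma adjoin_le_of_mul_mem {𝕜 R : Type*} [CommSemiring 𝕜] [Semiring R] [Algebra 𝕜 R] {s : Set R}
    {M : Submodule 𝕜 R} (one_mem : 1 ∈ M)
    (mul_mem : ∀ a ∈ s, ∀ w ∈ Algebra.adjoin 𝕜 s, w ∈ M → a * w ∈ M) :
    Subalgebra.toSubmodule (Algebra.adjoin 𝕜 s) ≤ M := by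
  rw [Algebra.adjoin_eq_span, Submodule.span_le]
  intro w hw
  induction hw using Submonoid.closure_induction_left with
  | one => exact one_mem
  | mul_left a ha w hw ih => exact mul_mem a ha w (Submonoid.closure_le.2
      (Algebra.subset_adjoin (s := s)) hw) ih

lemma tableauOp_mem {R S : Type*} [Ring R] [SetLike S R] [SubringClass S R] {n : ℕ} {s : S}
    {b : Fin n → R} (hb : ∀ i, b i ∈ s) (A : Tableau n) : tableauOp b A ∈ s := by
  have hmap := map_tableauOp (SubringClass.subtype s) (fun i => ⟨b i, hb i⟩) A
  simp only [SubringClass.subtype_apply] at hmap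
  rw [← hmap]
  exact SetLike.coe_mem _

section Enveloping

variable {n : ℕ}

variable (n) in
/-- The quotient map from the free algebra, with the enveloping algebra as its codomain. -/
def uospMk : FreeAlgebra ℂ (Fin n × ℤˣ) →ₐ[ℂ] UOsp n := RingQuot.mkAlgHom ℂ (Rel n)

lemma gen_triple (i j l : Fin n) (ξ η ε : ℤˣ) :
    (gen n ξ i * gen n η j + gen n η j * gen n ξ i) * gen n ε l
      - gen n ε l * (gen n ξ i * gen n η j + gen n η j * gen n ξ i)
      = (if i = l then (((ε : ℤ) - (ξ : ℤ) : ℤ) : ℂ) else 0) • gen n η j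
          + (if j = l then (((ε : ℤ) - (η : ℤ) : ℤ) : ℂ) else 0) • gen n ξ i := by
  have h : uospMk n _ = uospMk n _ := RingQuot.mkAlgHom_rel ℂ (Rel.triple i j l ξ η ε)
  simp only [map_sub, map_mul, map_add, map_smul] at h
  exact h

lemma gen_pos_tripleComm (n : ℕ) : TripleComm (gen n 1) := by
  intro i j l
  exact sub_eq_zero.1 (by simpa using gen_triple i j l 1 1 1)

lemma anticomm_mul_gen_pos (i j l : Fin n) :
    (gen n 1 j * gen n (-1) i + gen n (-1) i * gen n 1 j) * gen n 1 l
      = gen n 1 l * (gen n 1 j * gen n (-1) i + gen n (-1) i * gen n 1 j)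
        + (if i = l then (2 : ℂ) else 0) • gen n 1 j := by
  rw [← sub_eq_iff_eq_add', gen_triple j i l 1 (-1) 1]
  norm_num

lemma adjoin_range_gen (n : ℕ) :
    Algebra.adjoin ℂ (Set.range fun a : Fin n × ℤˣ => gen n a.2 a.1) = ⊤ := by
  have hrange : (Set.range fun a : Fin n × ℤˣ => gen n a.2 a.1)
      = uospMk n '' Set.range (FreeAlgebra.ι ℂ) := Set.range_comp (uospMk n) (FreeAlgebra.ι ℂ)
  rw [hrange, ← AlgHom.map_adjoin, FreeAlgebra.adjoin_range_ι, Algebra.map_top,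
    AlgHom.range_eq_top]
  exact RingQuot.mkAlgHom_surjective ℂ (Rel n)

variable (n) in
/-- The subalgebra generated by the raising operators `B_i^+`. -/
def raisingAlgebra : Subalgebra ℂ (UOsp n) := Algebra.adjoin ℂ (Set.range (gen n 1))

lemma gen_pos_mem_raisingAlgebra (i : Fin n) : gen n 1 i ∈ raisingAlgebra n :=
  Algebra.subset_adjoin (Set.mem_range_self i)

variable (n) in
/-- The elements `x` for which `x|0⟩ ∈ V̄_n(p)` equals `(u₀ + p u₁)|0⟩` for some `u₀, u₁` in the
raising algebra that do not depend on `p`. -/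
def affineInParameter : Submodule ℂ (UOsp n) where
  carrier := {x | ∃ u₀ ∈ raisingAlgebra n, ∃ u₁ ∈ raisingAlgebra n,
    ∀ p : ℕ, x - (u₀ + (p : ℂ) • u₁) ∈ vacuumIdeal n p}
  zero_mem' := ⟨0, zero_mem _, 0, zero_mem _, fun p => by simp⟩
  add_mem' := by
    rintro x y ⟨u₀, hu₀, u₁, hu₁, hx⟩ ⟨v₀, hv₀, v₁, hv₁, hy⟩
    refine ⟨u₀ + v₀, add_mem hu₀ hv₀, u₁ + v₁, add_mem hu₁ hv₁, fun p => ?_⟩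
    convert add_mem (hx p) (hy p) using 1
    module
  smul_mem' := by
    rintro c x ⟨u₀, hu₀, u₁, hu₁, hx⟩
    refine ⟨c • u₀, Subalgebra.smul_mem _ hu₀ c, c • u₁, Subalgebra.smul_mem _ hu₁ c, fun p => ?_⟩
    convert Submodule.smul_of_tower_mem (vacuumIdeal n p) c (hx p) using 1
    module

lemma raisingAlgebra_le_affineInParameter :
    Subalgebra.toSubmodule (raisingAlgebra n) ≤ affineInParameter n :=
  fun u hu => ⟨u, hu, 0, zero_mem _, fun p => by simp⟩

lemma gen_pos_mul_mem_affineInParameter (l : Fin n) {x : UOsp n} (hx : x ∈ affineInParameter n) :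
    gen n 1 l * x ∈ affineInParameter n := by
  obtain ⟨u₀, hu₀, u₁, hu₁, hx⟩ := hx
  have hl := gen_pos_mem_raisingAlgebra l
  refine ⟨gen n 1 l * u₀, mul_mem hl hu₀, gen n 1 l * u₁, mul_mem hl hu₁, fun p => ?_⟩
  convert Ideal.mul_mem_left _ (gen n 1 l) (hx p) using 1
  rw [mul_sub, mul_add, mul_smul_comm]

lemma gen_neg_mem_affineInParameter (i : Fin n) : gen n (-1) i ∈ affineInParameter n :=
  ⟨0, zero_mem _, 0, zero_mem _, fun p => by
    rw [smul_zero, add_zero, sub_zero]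
    exact Ideal.subset_span (Or.inl (Or.inl ⟨i, rfl⟩))⟩

lemma anticomm_mem_affineInParameter (i j : Fin n) :
    gen n 1 j * gen n (-1) i + gen n (-1) i * gen n 1 j ∈ affineInParameter n := by
  refine ⟨0, zero_mem _, (if j = i then 1 else 0 : ℂ) • 1, Subalgebra.smul_mem _ (one_mem _) _,
    fun p => ?_⟩
  rw [zero_add, smul_smul, mul_ite, mul_one, mul_zero, ← Algebra.algebraMap_eq_smul_one]
  exact Ideal.subset_span (Or.inr ⟨(j, i), rfl⟩)

lemma anticomm_mul_mem_affineInParameter (i j : Fin n) {w : UOsp n} (hw : w ∈ raisingAlgebra n) :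
    (gen n 1 j * gen n (-1) i + gen n (-1) i * gen n 1 j) * w ∈ affineInParameter n := by
  set x := gen n 1 j * gen n (-1) i + gen n (-1) i * gen n 1 j
  have hle : Subalgebra.toSubmodule (raisingAlgebra n)
      ≤ (affineInParameter n).comap (LinearMap.mulLeft ℂ x) := by
    refine adjoin_le_of_mul_mem ?_ ?_
    · simpa using anticomm_mem_affineInParameter i j
    · rintro _ ⟨l, rfl⟩ w hw hxw
      rw [Submodule.mem_comap, LinearMap.mulLeft_apply, ← mul_assoc, anticomm_mul_gen_pos, add_mul,
        mul_assoc, smul_mul_assoc]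
      have hjw : gen n 1 j * w ∈ raisingAlgebra n := mul_mem (gen_pos_mem_raisingAlgebra j) hw
      exact add_mem (gen_pos_mul_mem_affineInParameter l hxw)
        (Submodule.smul_mem _ _ (raisingAlgebra_le_affineInParameter hjw))
  exact hle hw

lemma gen_neg_mul_mem_affineInParameter (i : Fin n) {w : UOsp n} (hw : w ∈ raisingAlgebra n) :
    gen n (-1) i * w ∈ affineInParameter n := by
  have hle : Subalgebra.toSubmodule (raisingAlgebra n)
      ≤ (affineInParameter n).comap (LinearMap.mulLeft ℂ (gen n (-1) i)) := by
    refine adjoin_le_of_mul_mem ?_ ?_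
    · simpa using gen_neg_mem_affineInParameter i
    · rintro _ ⟨l, rfl⟩ w hw hiw
      have hmove : gen n (-1) i * (gen n 1 l * w)
          = (gen n 1 l * gen n (-1) i + gen n (-1) i * gen n 1 l) * w
            - gen n 1 l * (gen n (-1) i * w) := by noncomm_ring
      rw [Submodule.mem_comap, LinearMap.mulLeft_apply, hmove]
      exact sub_mem (anticomm_mul_mem_affineInParameter i l hw)
        (gen_pos_mul_mem_affineInParameter l hiw)
  exact hle hw

/-- The normalised tableau products in the enveloping algebra, so that `ṽ_A = tab A |0⟩`. -/
noncomputable def tab (A : Tableau n) : UOsp n :=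
  (A.shapeFactorial : ℂ)⁻¹ • tableauOp (gen n 1) A

lemma tab_mem_raisingAlgebra (A : Tableau n) : tab A ∈ raisingAlgebra n :=
  Subalgebra.smul_mem _ (tableauOp_mem gen_pos_mem_raisingAlgebra A) _

lemma tab_empty : tab (Tableau.empty n) = 1 := by
  simp [tab, tableauOp_empty, Tableau.shapeFactorial, Tableau.cols_empty]

lemma exists_linearCombination_tab_eq {u : UOsp n} (hu : u ∈ raisingAlgebra n) :
    ∃ c : Tableau n →₀ ℂ, Finsupp.linearCombination ℂ tab c = u := by
  have hspan : Submodule.span ℂ (Set.range (tableauOp (gen n 1)))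
      ≤ Submodule.span ℂ (Set.range tab) := by
    rw [Submodule.span_le]
    rintro _ ⟨A, rfl⟩
    rw [← inv_smul_smul₀ (inv_ne_zero (shapeFactorial_ne_zero A)) (tableauOp (gen n 1) A)]
    exact Submodule.smul_mem _ _ (Submodule.subset_span ⟨A, rfl⟩)
  exact Finsupp.mem_span_range_iff_exists_finsupp.1
    (hspan (adjoin_le_span_tableauOp (gen_pos_tripleComm n) hu))

lemma exists_gen_pos_mul_tab (i : Fin n) (A : Tableau n) : ∃ c : Tableau n →₀ ℂ,
    Finsupp.linearCombination ℂ tab c = gen n 1 i * tab A :=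
  exists_linearCombination_tab_eq
    (mul_mem (gen_pos_mem_raisingAlgebra i) (tab_mem_raisingAlgebra A))

lemma exists_gen_neg_mul_tab (i : Fin n) (A : Tableau n) : ∃ c₀ c₁ : Tableau n →₀ ℂ, ∀ p : ℕ,
    gen n (-1) i * tab A - Finsupp.linearCombination ℂ tab (c₀ + (p : ℂ) • c₁)
      ∈ vacuumIdeal n p := by
  obtain ⟨u₀, hu₀, u₁, hu₁, h⟩ := gen_neg_mul_mem_affineInParameter i (tab_mem_raisingAlgebra A)
  obtain ⟨c₀, rfl⟩ := exists_linearCombination_tab_eq hu₀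
  obtain ⟨c₁, rfl⟩ := exists_linearCombination_tab_eq hu₁
  exact ⟨c₀, c₁, fun p => by simpa using h p⟩

/-- The coefficients of `B_i^+` on the normalised tableau products. -/
noncomputable def raise (i : Fin n) (A : Tableau n) : Tableau n →₀ ℂ :=
  (exists_gen_pos_mul_tab i A).choose

lemma linearCombination_tab_raise (i : Fin n) (A : Tableau n) :
    Finsupp.linearCombination ℂ tab (raise i A) = gen n 1 i * tab A :=
  (exists_gen_pos_mul_tab i A).choose_spec

/-- The constant part of the coefficients of `B_i^-`, which are affine in `p`. -/
noncomputable def lowerConst (i : Fin n) (A : Tableau n) : Tableau n →₀ ℂ :=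
  (exists_gen_neg_mul_tab i A).choose

/-- The slope of the coefficients of `B_i^-`, which are affine in `p`. -/
noncomputable def lowerSlope (i : Fin n) (A : Tableau n) : Tableau n →₀ ℂ :=
  (exists_gen_neg_mul_tab i A).choose_spec.choose

lemma gen_neg_mul_tab_sub_mem (p : ℕ) (i : Fin n) (A : Tableau n) :
    gen n (-1) i * tab A
      - Finsupp.linearCombination ℂ tab (lowerConst i A + (p : ℂ) • lowerSlope i A)
      ∈ vacuumIdeal n p :=
  (exists_gen_neg_mul_tab i A).choose_spec.choose_spec p

end Enveloping

/-! ### The actions on the tableau vectors -/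

section Actions

variable {n : ℕ}

/-- The map `u ↦ u|0⟩`. -/
noncomputable def toVBar (n p : ℕ) : UOsp n →ₗ[ℂ] VBar n p :=
  (LinearMap.toSpanSingleton (UOsp n) (VBar n p) (vacuum n p)).restrictScalars ℂ

lemma toVBar_apply (n p : ℕ) (u : UOsp n) : toVBar n p u = u • vacuum n p := rfl

lemma toVBar_eq_mk (n p : ℕ) (u : UOsp n) :
    toVBar n p u = (Submodule.Quotient.mk u : UOsp n ⧸ vacuumIdeal n p) :=
  congrArg (Submodule.Quotient.mk (p := vacuumIdeal n p)) (mul_one u)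

lemma toVBar_eq_zero_iff {p : ℕ} {u : UOsp n} : toVBar n p u = 0 ↔ u ∈ vacuumIdeal n p := by
  rw [toVBar_eq_mk]
  exact Submodule.Quotient.mk_eq_zero _

lemma toVBar_surjective (n p : ℕ) : Function.Surjective (toVBar n p) := fun w =>
  (Submodule.Quotient.mk_surjective (vacuumIdeal n p) w).imp fun u hu =>
    (toVBar_eq_mk n p u).trans hu

lemma toVBar_tab (p : ℕ) (A : Tableau n) : toVBar n p (tab A) = vTilde n p A := by
  rw [tab, map_smul, toVBar_apply, vTilde, v]

/-- The map `u ↦ u(1)`. -/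
noncomputable def toClPoly (n q : ℕ) : UOsp n →ₗ[ℂ] ClPoly n q :=
  (LinearMap.applyₗ (1 : ClPoly n q)) ∘ₗ (realization n q).toLinearMap

lemma toClPoly_apply (n q : ℕ) (u : UOsp n) : toClPoly n q u = realization n q u 1 := rfl

lemma toClPoly_tab (q : ℕ) (A : Tableau n) : toClPoly n q (tab A) = ωTilde n q A := by
  have hX : (fun i => realization n q (gen n 1 i)) = X n q := funext (realization_gen_pos q)
  rw [tab, map_smul, toClPoly_apply, map_tableauOp, hX, ωTilde, ω]

lemma map_linearCombination_tab {M : Type*} [AddCommGroup M] [Module ℂ M] {f : UOsp n →ₗ[ℂ] M}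
    {g : Tableau n → M} (hfg : ∀ A, f (tab A) = g A) (c : Tableau n →₀ ℂ) :
    f (Finsupp.linearCombination ℂ tab c) = Finsupp.linearCombination ℂ g c := by
  rw [Finsupp.apply_linearCombination, ← funext hfg]
  rfl

lemma gen_pos_smul_vTilde (p : ℕ) (i : Fin n) (A : Tableau n) :
    gen n 1 i • vTilde n p A = Finsupp.linearCombination ℂ (vTilde n p) (raise i A) := by
  rw [← map_linearCombination_tab (toVBar_tab p), linearCombination_tab_raise,
    ← toVBar_tab, toVBar_apply, toVBar_apply, mul_smul]

lemma gen_neg_smul_vTilde (p : ℕ) (i : Fin n) (A : Tableau n) :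
    gen n (-1) i • vTilde n p A = Finsupp.linearCombination ℂ (vTilde n p)
      (lowerConst i A + (p : ℂ) • lowerSlope i A) := by
  have h := toVBar_eq_zero_iff.2 (gen_neg_mul_tab_sub_mem p i A)
  rw [map_sub, sub_eq_zero] at h
  rw [← map_linearCombination_tab (toVBar_tab p), ← h, ← toVBar_tab, toVBar_apply, toVBar_apply,
    mul_smul]

lemma X_ωTilde (q : ℕ) (i : Fin n) (A : Tableau n) :
    X n q i (ωTilde n q A) = Finsupp.linearCombination ℂ (ωTilde n q) (raise i A) := by
  rw [← map_linearCombination_tab (toClPoly_tab q), linearCombination_tab_raise,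
    ← toClPoly_tab, toClPoly_apply, toClPoly_apply, map_mul, realization_gen_pos,
    Module.End.mul_apply]

lemma D_ωTilde (q : ℕ) (i : Fin n) (A : Tableau n) :
    D n q i (ωTilde n q A) = Finsupp.linearCombination ℂ (ωTilde n q)
      (lowerConst i A + (q : ℂ) • lowerSlope i A) := by
  have h := realization_one_of_mem (gen_neg_mul_tab_sub_mem q i A)
  rw [← toClPoly_apply, map_sub, sub_eq_zero] at h
  rw [← map_linearCombination_tab (toClPoly_tab q), ← h, ← toClPoly_tab, toClPoly_apply,
    toClPoly_apply, map_mul, realization_gen_neg, Module.End.mul_apply]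

lemma linearIndependent_ωTilde_of_le {q : ℕ} (h : n ≤ q) : LinearIndependent ℂ (ωTilde n q) :=
  (linearIndependent_ωTilde n q).comp (fun A : Tableau n => ⟨A, A.rows_le.trans h⟩)
    fun _ _ hAB => congrArg Subtype.val hAB

lemma coords_linearCombination {q : ℕ} (h : n ≤ q) (c : Tableau n →₀ ℂ) :
    coords n q (Finsupp.linearCombination ℂ (ωTilde n q) c) = c := by
  have hex : ∃ d : Tableau n →₀ ℂ, (∀ B, q < B.rows → d B = 0) ∧
      Finsupp.linearCombination ℂ (ωTilde n q) c = Finsupp.linearCombination ℂ (ωTilde n q) d :=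
    ⟨c, fun B hB => absurd (hB.trans_le B.rows_le) (not_lt.2 h), rfl⟩
  exact (linearIndependent_ωTilde_of_le h (Classical.epsilon_spec hex).2).symm

lemma cBar_self (i : Fin n) (A : Tableau n) : cBar n n i A = raise i A := by
  rw [cBar, X_ωTilde, coords_linearCombination le_rfl]

lemma cHat_of_le {q : ℕ} (h : n ≤ q) (i : Fin n) (A : Tableau n) :
    cHat n q i A = lowerConst i A + (q : ℂ) • lowerSlope i A := by
  rw [cHat, D_ωTilde, coords_linearCombination h]

lemma cHat_interpolation (p : ℕ) (i : Fin n) (A : Tableau n) :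
    ((n : ℂ) + 1 - p) • cHat n n i A - ((n : ℂ) - p) • cHat n (n + 1) i A
      = lowerConst i A + (p : ℂ) • lowerSlope i A := by
  rw [cHat_of_le le_rfl, cHat_of_le (Nat.le_succ n)]
  push_cast
  module

lemma linearCombination_ωTilde_filter (q : ℕ) (c : Tableau n →₀ ℂ) :
    Finsupp.linearCombination ℂ (ωTilde n q) (c.filter fun B => B.rows ≤ q)
      = Finsupp.linearCombination ℂ (ωTilde n q) c := by
  conv_rhs => rw [← Finsupp.filter_add_filter_not c fun B => B.rows ≤ q]
  rw [map_add, left_eq_add, Finsupp.linearCombination_apply]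
  refine Finset.sum_eq_zero fun B hB => ?_
  rw [Finsupp.support_filter, Finset.mem_filter] at hB
  simp only [ωTilde_eq_zero (not_le.1 hB.2), smul_zero]

end Actions

section Spanning

variable {n : ℕ}

lemma gen_mul_tab_mem (p : ℕ) (ξ : ℤˣ) (i : Fin n) (A : Tableau n) :
    gen n ξ i * tab A ∈
      Submodule.span ℂ (Set.range tab) ⊔ (vacuumIdeal n p).restrictScalars ℂ := by
  have hspan (c : Tableau n →₀ ℂ) :
      Finsupp.linearCombination ℂ tab c ∈ Submodule.span ℂ (Set.range tab) :=
    Finsupp.mem_span_range_iff_exists_finsupp.2 ⟨c, rfl⟩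
  rcases Int.units_eq_one_or ξ with rfl | rfl
  · rw [← linearCombination_tab_raise]
    exact Submodule.mem_sup_left (hspan _)
  · rw [← add_sub_cancel (Finsupp.linearCombination ℂ tab _) (gen n (-1) i * tab A)]
    exact Submodule.add_mem_sup (hspan _) (gen_neg_mul_tab_sub_mem p i A)

lemma span_tab_sup_vacuumIdeal (n p : ℕ) :
    Submodule.span ℂ (Set.range tab) ⊔ (vacuumIdeal n p).restrictScalars ℂ = ⊤ := by
  set M := Submodule.span ℂ (Set.range tab) ⊔ (vacuumIdeal n p).restrictScalars ℂ
  have hmul (ξ : ℤˣ) (i : Fin n) : M ≤ M.comap (LinearMap.mulLeft ℂ (gen n ξ i)) := by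
    refine sup_le (Submodule.span_le.2 ?_) fun u hu =>
      Submodule.mem_sup_right ((vacuumIdeal n p).mul_mem_left _ hu)
    rintro _ ⟨A, rfl⟩
    exact gen_mul_tab_mem p ξ i A
  have hle : Subalgebra.toSubmodule (Algebra.adjoin ℂ
      (Set.range fun a : Fin n × ℤˣ => gen n a.2 a.1)) ≤ M := by
    refine adjoin_le_of_mul_mem ?_ ?_
    · rw [← tab_empty]
      exact Submodule.mem_sup_left (Submodule.subset_span ⟨_, rfl⟩)
    · rintro _ ⟨a, rfl⟩ w _ hw
      exact hmul a.2 a.1 hw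
  rwa [adjoin_range_gen, Algebra.top_toSubmodule, top_le_iff] at hle

lemma range_eq_span_of_vacuumIdeal_le_ker {M : Type*} [AddCommGroup M] [Module ℂ M] {p : ℕ}
    {f : UOsp n →ₗ[ℂ] M} (hf : (vacuumIdeal n p).restrictScalars ℂ ≤ f.ker) {g : Tableau n → M}
    (hfg : ∀ A, f (tab A) = g A) : f.range = Submodule.span ℂ (Set.range g) := by
  rw [LinearMap.range_eq_map, ← span_tab_sup_vacuumIdeal n p, Submodule.map_sup,
    LinearMap.le_ker_iff_map.1 hf, sup_bot_eq, Submodule.map_span, ← Set.range_comp]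
  exact congrArg (fun g => Submodule.span ℂ (Set.range g)) (funext hfg)

lemma span_vTilde (n p : ℕ) : Submodule.span ℂ (Set.range (vTilde n p)) = ⊤ := by
  rw [← range_eq_span_of_vacuumIdeal_le_ker (fun _ => toVBar_eq_zero_iff.2) (toVBar_tab p)]
  exact LinearMap.range_eq_top.2 (toVBar_surjective n p)

lemma range_realization (n q : ℕ) :
    (realization n q).range = Algebra.adjoin ℂ (Set.range (X n q) ∪ Set.range (D n q)) := by
  have hgen : realization n q '' (Set.range fun a : Fin n × ℤˣ => gen n a.2 a.1)
      = Set.range (X n q) ∪ Set.range (D n q) := by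
    refine Set.Subset.antisymm ?_ (Set.union_subset ?_ ?_)
    · rintro _ ⟨_, ⟨⟨i, ξ⟩, rfl⟩, rfl⟩
      rcases Int.units_eq_one_or ξ with rfl | rfl
      · exact Or.inl ⟨i, (realization_gen_pos q i).symm⟩
      · exact Or.inr ⟨i, (realization_gen_neg q i).symm⟩
    · rintro _ ⟨i, rfl⟩
      exact ⟨_, ⟨(i, 1), rfl⟩, realization_gen_pos q i⟩
    · rintro _ ⟨i, rfl⟩
      exact ⟨_, ⟨(i, -1), rfl⟩, realization_gen_neg q i⟩
  rw [← Algebra.map_top, ← adjoin_range_gen, AlgHom.map_adjoin, hgen]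

lemma range_toClPoly (n q : ℕ) : (toClPoly n q).range = L n q := by
  rw [toClPoly, LinearMap.range_comp, L, ← range_realization]
  rfl

lemma span_ωTilde (n q : ℕ) :
    Submodule.span ℂ (Set.range fun A : {A : Tableau n // A.rows ≤ q} => ωTilde n q A.1)
      = L n q := by
  rw [← range_toClPoly,
    range_eq_span_of_vacuumIdeal_le_ker (fun _ => realization_one_of_mem) (toClPoly_tab q)]
  refine le_antisymm (Submodule.span_mono ?_) (Submodule.span_le.2 ?_)
  · rintro _ ⟨A, rfl⟩
    exact ⟨A.1, rfl⟩
  · rintro _ ⟨A, rfl⟩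
    by_cases hA : A.rows ≤ q
    · exact Submodule.subset_span ⟨⟨A, hA⟩, rfl⟩
    · rw [ωTilde_eq_zero (not_le.1 hA)]
      exact zero_mem _

end Spanning

/-! ### Linear independence in the induced module -/

section Specialization

open scoped Polynomial

variable {ι R : Type*} [CommSemiring R]

/-- Evaluation at `p` of the coefficients of a vector over the polynomial ring. -/
noncomputable def specialize (p : R) : (ι →₀ R[X]) →ₗ[R] (ι →₀ R) :=
  Finsupp.mapRange.linearMap (Polynomial.leval p)

lemma specialize_apply (p : R) (m : ι →₀ R[X]) (i : ι) : specialize p m i = (m i).eval p := rfl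

lemma specialize_smul (p : R) (P : R[X]) (m : ι →₀ R[X]) :
    specialize p (P • m) = P.eval p • specialize p m := by
  ext i
  simp only [specialize_apply, Finsupp.smul_apply, smul_eq_mul, Polynomial.eval_mul]

lemma specialize_single (p : R) (i : ι) (P : R[X]) :
    specialize p (Finsupp.single i P) = Finsupp.single i (P.eval p) :=
  Finsupp.mapRange_single (hf := map_zero _)

lemma eq_of_infinite_specialize_eq {R : Type*} [CommRing R] [IsDomain R] {S : Set R}
    (hS : S.Infinite) {m m' : ι →₀ R[X]} (h : ∀ p ∈ S, specialize p m = specialize p m') :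
    m = m' := by
  ext1 i
  exact Polynomial.eq_of_infinite_eval_eq _ _ (hS.mono fun p hp => DFunLike.congr_fun (h p hp) i)

lemma specialize_map_eq_zero (T : Module.End R[X] (ι →₀ R[X])) {p : R} {m : ι →₀ R[X]}
    (hm : specialize p m = 0) : specialize p (T m) = 0 := by
  rw [← Finsupp.sum_single m, Finsupp.sum, map_sum, map_sum]
  refine Finset.sum_eq_zero fun i _ => ?_
  have hi : (m i).eval p = 0 := DFunLike.congr_fun hm i
  rw [← mul_one (m i), ← smul_eq_mul, ← Finsupp.smul_single, map_smul, specialize_smul, hi,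
    zero_smul]

/-- A vector over `R`, regarded as a vector over the polynomial ring. -/
noncomputable def constVec : (ι →₀ R) →ₗ[R] (ι →₀ R[X]) :=
  Finsupp.mapRange.linearMap (Algebra.linearMap R R[X])

lemma specialize_constVec (p : R) (c : ι →₀ R) : specialize p (constVec c) = c := by
  ext i
  exact Polynomial.eval_C

end Specialization

section TableauModule

open scoped Polynomial

variable {n : ℕ}

/-- The operator by which `B_i^ξ`, for `a = (i, ξ)`, acts on the formal span of all tableaux, with
the parameter `p` of the induced module as the polynomial variable. -/
noncomputable def formalOp (a : Fin n × ℤˣ) : Module.End ℂ[X] (Tableau n →₀ ℂ[X]) :=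
  Finsupp.linearCombination ℂ[X] fun A =>
    if a.2 = 1 then constVec (raise a.1 A)
    else constVec (lowerConst a.1 A) + (Polynomial.X : ℂ[X]) • constVec (lowerSlope a.1 A)

/-- The formal span of all tableaux, specialised at `q` and mapped to `L_n(q)`. -/
noncomputable def evalωTilde (n q : ℕ) : (Tableau n →₀ ℂ[X]) →ₗ[ℂ] ClPoly n q :=
  Finsupp.linearCombination ℂ (ωTilde n q) ∘ₗ specialize (q : ℂ)

lemma evalωTilde_single (q : ℕ) (A : Tableau n) :
    evalωTilde n q (Finsupp.single A 1) = ωTilde n q A := by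
  rw [evalωTilde, LinearMap.comp_apply, specialize_single, Polynomial.eval_one,
    Finsupp.linearCombination_single, one_smul]

lemma eq_of_evalωTilde_eq {m m' : Tableau n →₀ ℂ[X]}
    (h : ∀ q, evalωTilde n q m = evalωTilde n q m') : m = m' := by
  have hinf : ((Nat.cast : ℕ → ℂ) '' Set.Ici n).Infinite :=
    (Set.Ici_infinite n).image Nat.cast_injective.injOn
  refine eq_of_infinite_specialize_eq hinf ?_
  rintro _ ⟨q, hq, rfl⟩
  exact linearIndependent_ωTilde_of_le hq (h q)

lemma evalωTilde_formalOp (q : ℕ) (a : Fin n × ℤˣ) (m : Tableau n →₀ ℂ[X]) :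
    evalωTilde n q (formalOp a m) = realOp q a (evalωTilde n q m) := by
  induction m using Finsupp.induction_linear with
  | zero => simp only [map_zero]
  | add x y hx hy => simp only [map_add, hx, hy]
  | single A P =>
    simp only [evalωTilde, LinearMap.comp_apply, formalOp, Finsupp.linearCombination_single,
      specialize_smul, specialize_single, map_smul]
    rw [realOp]
    split_ifs
    · rw [specialize_constVec, X_ωTilde]
    · rw [map_add, specialize_smul, specialize_constVec, specialize_constVec, Polynomial.eval_X,
        D_ωTilde]

lemma formalOp_triple (a b c : Fin n × ℤˣ) :
    (formalOp a * formalOp b + formalOp b * formalOp a) * formalOp c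
        - formalOp c * (formalOp a * formalOp b + formalOp b * formalOp a)
      = (if a.1 = c.1 then (((c.2 : ℤ) - (a.2 : ℤ) : ℤ) : ℂ) else 0) • formalOp b
        + (if b.1 = c.1 then (((c.2 : ℤ) - (b.2 : ℤ) : ℤ) : ℂ) else 0) • formalOp a := by
  refine LinearMap.ext fun m => eq_of_evalωTilde_eq fun q => ?_
  simpa only [map_sub, map_add, map_smul, LinearMap.sub_apply, LinearMap.add_apply,
    LinearMap.smul_apply, Module.End.mul_apply, evalωTilde_formalOp]
    using LinearMap.congr_fun (realOp_triple q a b c) (evalωTilde n q m)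

variable (n) in
/-- The action of `osp(1|2n)` on the formal span of all tableaux. -/
noncomputable def formalRep : UOsp n →ₐ[ℂ] Module.End ℂ[X] (Tableau n →₀ ℂ[X]) :=
  RingQuot.liftAlgHom ℂ (s := Rel n)
    ⟨FreeAlgebra.lift ℂ formalOp, by
      rintro _ _ ⟨i, j, l, ξ, η, ε⟩
      simpa only [map_sub, map_mul, map_add, map_smul, FreeAlgebra.lift_ι_apply]
        using formalOp_triple (i, ξ) (j, η) (l, ε)⟩

lemma formalRep_gen (ξ : ℤˣ) (i : Fin n) : formalRep n (gen n ξ i) = formalOp (i, ξ) :=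
  (RingQuot.liftAlgHom_mkAlgHom_apply ..).trans (FreeAlgebra.lift_ι_apply ..)

lemma evalωTilde_formalRep (q : ℕ) (u : UOsp n) (m : Tableau n →₀ ℂ[X]) :
    evalωTilde n q (formalRep n u m) = realization n q u (evalωTilde n q m) := by
  have hu : u ∈ Algebra.adjoin ℂ (Set.range fun a : Fin n × ℤˣ => gen n a.2 a.1) := by
    rw [adjoin_range_gen]
    exact Algebra.mem_top
  induction hu using Algebra.adjoin_induction generalizing m with
  | mem _ hx =>
    obtain ⟨a, rfl⟩ := hx
    rw [formalRep_gen, realization_gen, evalωTilde_formalOp]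
  | algebraMap r => simp only [AlgHom.commutes, Module.algebraMap_end_apply, map_smul]
  | add x y _ _ hx hy => simp only [map_add, LinearMap.add_apply, hx, hy]
  | mul x y _ _ hx hy => simp only [map_mul, Module.End.mul_apply, hx, hy]

variable (n) in
/-- The lowest weight vector of the formal span of all tableaux. -/
noncomputable def formalVacuum : Tableau n →₀ ℂ[X] := Finsupp.single (Tableau.empty n) 1

lemma evalωTilde_formalVacuum (q : ℕ) : evalωTilde n q (formalVacuum n) = 1 := by
  rw [formalVacuum, evalωTilde_single, ← toClPoly_tab, tab_empty, toClPoly_apply,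
    map_one (realization n q), Module.End.one_apply]

lemma formalRep_formalVacuum_eq {u : UOsp n} {m : Tableau n →₀ ℂ[X]}
    (h : ∀ q, realization n q u 1 = evalωTilde n q m) : formalRep n u (formalVacuum n) = m :=
  eq_of_evalωTilde_eq fun q => by rw [evalωTilde_formalRep, evalωTilde_formalVacuum, h]

lemma formalRep_tab_formalVacuum (A : Tableau n) :
    formalRep n (tab A) (formalVacuum n) = Finsupp.single A 1 :=
  formalRep_formalVacuum_eq fun q => by
    rw [evalωTilde_single, ← toClPoly_tab, toClPoly_apply]

lemma formalRep_anticomm_formalVacuum (i j : Fin n) :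
    formalRep n (gen n 1 i * gen n (-1) j + gen n (-1) j * gen n 1 i) (formalVacuum n)
      = (if i = j then Polynomial.X else 0 : ℂ[X]) • formalVacuum n := by
  refine formalRep_formalVacuum_eq fun q => ?_
  have hmem := realization_one_of_mem (q := q) (Ideal.subset_span (Or.inr ⟨(i, j), rfl⟩))
  rw [map_sub, LinearMap.sub_apply, sub_eq_zero] at hmem
  rw [hmem, AlgHom.commutes, Module.algebraMap_end_apply, ← evalωTilde_formalVacuum, evalωTilde,
    LinearMap.comp_apply, LinearMap.comp_apply, specialize_smul, map_smul]
  split_ifs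
  · rw [Polynomial.eval_X]
  · rw [Polynomial.eval_zero]

lemma specialize_formalRep_eq_zero {p : ℕ} {u : UOsp n} (hu : u ∈ vacuumIdeal n p) :
    specialize (p : ℂ) (formalRep n u (formalVacuum n)) = 0 := by
  induction hu using Submodule.span_induction with
  | zero => simp only [map_zero, LinearMap.zero_apply]
  | add x y _ _ hx hy => simp only [map_add, LinearMap.add_apply, hx, hy, add_zero]
  | smul a x _ hx =>
    rw [smul_eq_mul, map_mul, Module.End.mul_apply]
    exact specialize_map_eq_zero _ hx
  | mem x hx =>
    rcases hx with hx | ⟨⟨i, j⟩, rfl⟩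
    · have hzero : formalRep n x (formalVacuum n) = 0 := formalRep_formalVacuum_eq fun q => by
        rw [realization_one_of_mem (Ideal.subset_span (Or.inl hx)), map_zero]
      rw [hzero, map_zero]
    · rw [map_sub, LinearMap.sub_apply, formalRep_anticomm_formalVacuum, AlgHom.commutes,
        Module.algebraMap_end_apply, map_sub, specialize_smul, map_smul, sub_eq_zero]
      split_ifs
      · rw [Polynomial.eval_X]
      · rw [Polynomial.eval_zero]

theorem linearIndependent_vTilde (n p : ℕ) : LinearIndependent ℂ (vTilde n p) := by
  refine linearIndependent_iff.2 fun c hc => ?_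
  rw [← map_linearCombination_tab (toVBar_tab p), toVBar_eq_zero_iff] at hc
  set toFormal : UOsp n →ₗ[ℂ] Tableau n →₀ ℂ := specialize (p : ℂ) ∘ₗ
    (LinearMap.applyₗ (formalVacuum n)).restrictScalars ℂ ∘ₗ (formalRep n).toLinearMap
  have htab (A : Tableau n) : toFormal (tab A) = Finsupp.single A 1 := by
    simp [toFormal, formalRep_tab_formalVacuum, specialize_single]
  calc c = Finsupp.linearCombination ℂ (fun A => Finsupp.single A (1 : ℂ)) c := by
        simp [Finsupp.linearCombination_apply]
    _ = toFormal (Finsupp.linearCombination ℂ tab c) := (map_linearCombination_tab htab c).symm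
    _ = 0 := specialize_formalRep_eq_zero hc

end TableauModule

end Paraboson

open Paraboson in
theorem proposition6p5 (n p : ℕ) (hn : 0 < n) (hp : 0 < p) :
    -- the tableau vectors are bases, so that all matrix elements below are well defined
    (∀ q : ℕ, 0 < q →
      LinearIndependent ℂ (fun A : {A : Tableau n // A.rows ≤ q} => ωTilde n q A.1) ∧
      Submodule.span ℂ (Set.range fun A : {A : Tableau n // A.rows ≤ q} => ωTilde n q A.1)
        = L n q) ∧
    LinearIndependent ℂ (vTilde n p) ∧
    Submodule.span ℂ (Set.range (vTilde n p)) = ⊤ ∧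
    -- the actions on the induced module
    (∀ (i : Fin n) (A : Tableau n),
      gen n 1 i • vTilde n p A
        = Finsupp.linearCombination ℂ (vTilde n p) (cBar n n i A) ∧
      gen n (-1) i • vTilde n p A
        = Finsupp.linearCombination ℂ (vTilde n p)
            (((n : ℂ) + 1 - p) • cHat n n i A - ((n : ℂ) - p) • cHat n (n + 1) i A)) ∧
    -- the actions on `L_n(p)`, with sums only over tableaux with at most `p` rows
    (∀ (i : Fin n) (A : Tableau n), A.rows ≤ p →
      X n p i (ωTilde n p A)
        = Finsupp.linearCombination ℂ (ωTilde n p)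
            ((cBar n n i A).filter fun B => B.rows ≤ p) ∧
      D n p i (ωTilde n p A)
        = Finsupp.linearCombination ℂ (ωTilde n p)
            ((((n : ℂ) + 1 - p) • cHat n n i A
              - ((n : ℂ) - p) • cHat n (n + 1) i A).filter fun B => B.rows ≤ p)) := by
  refine ⟨fun q _ => ⟨linearIndependent_ωTilde n q, span_ωTilde n q⟩,
    linearIndependent_vTilde n p, span_vTilde n p, fun i A => ⟨?_, ?_⟩, fun i A _ => ⟨?_, ?_⟩⟩
  · rw [cBar_self, gen_pos_smul_vTilde]
  · rw [cHat_interpolation, gen_neg_smul_vTilde]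
  · rw [cBar_self, linearCombination_ωTilde_filter, X_ωTilde]
  · rw [cHat_interpolation, linearCombination_ωTilde_filter, D_ωTilde]
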